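/- **Setting.** Fix disjoint countably infinite sets of constants, labelled nulls and variables; every relation symbol $R$ has an arity $\mathsf{ar}(R)\ge 1$. A *database* is a finite set of facts (atoms over constants); an *instance* is a possibly infinite set of atoms over constants and nulls. A *TGD* is a constant-free sentence $\sigma=\forall\bar x\forall\bar y(\phi(\bar x,\bar y)\to\exists\bar z\,\psi(\bar x,\bar z))$ whose body $\phi$ and head $\psi$ are non-empty finite conjunctions (treated as sets) of atoms; its frontier $\mathsf{fr}(\sigma)$ is the set of variables that occur in both body and head. It is *linear* if its body is a single atom. For a finite set $\Sigma$ of TGDs, $\mathsf{sch}(\Sigma)$ is the set of its predicates, $\mathsf{ar}(\Sigma)$ their maximum arity ($0$ if $\Sigma=\emptyset$), $\mathsf{atoms}(\Sigma)$ the set of atoms occurring in it, and $\|\Sigma\|=|\mathsf{atoms}(\Sigma)|\cdot|\mathsf{sch}(\Sigma)|\cdot\mathsf{ar}(\Sigma)$. **Chase.** A *trigger* for $\Sigma$ on an instance $I$ is a pair $(\sigma,h)$ with $\sigma\in\Sigma$ and $h$ a homomorphism from the body of $\sigma$ to $I$. Its result is the image of the head under the map that is $h$ on $\mathsf{fr}(\sigma)$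 and sends each existential variable $z$ to the null $\bot^{z}_{\sigma,h|_{\mathsf{fr}(\sigma)}}$, which is determined uniquely by its indices. The trigger is *active* if its result is not contained in $I$. A *valid (semi-oblivious) chase derivation* of $D$ w.r.t. $\Sigma$ starts with $D$ and adds in each step the result of an active trigger; it is either finite, ending in an instance without active triggers, or infinite and *fair*, i.e. no trigger stays active forever. Its *result* is its last instance, respectively the union of its instances. **Weak-acyclicity.** The dependency graph of $\Sigma$ has as nodes the positions $(R,i)$ of $\mathsf{sch}(\Sigma)$. For each $\sigma\in\Sigma$, each $x\in\mathsf{fr}(\sigma)$ and each position $\pi$ of $x$ in the body, it has a normal edge from $\pi$ to every position of $x$ in the head, and a special edge from $\pi$ to every position in the head of an existential variable. For $R,P\in\mathsf{sch}(\Sigma)$ write $R\to_\Sigma P$ if $R=P$ or some $\sigma\in\Sigma$ has $R$ in its body and $P$ in its head; *reachability* is the transitive closure of $\to_\Sigma$. $\Sigma$ is *$D$-weakly-acyclic* if no (not necessarily simple) cycle of the dependency graph contains both a special edge and a node $(P,i)$ with $P$ reachable from the predicate of some fact of $D$. **Simplification.** For a tuple $\bar t$, let $\mathsf{unique}(\bar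 t)$ keep only the first occurrence of each term, and let $\mathsf{id}(\bar t)$ be the tuple whose $i$-th component is the index of $t_i$ in $\mathsf{unique}(\bar t)$. Put $\mathsf{simple}(R(\bar t))=R_{\mathsf{id}(\bar t)}(\mathsf{unique}(\bar t))$, where each $R_{\bar\ell}$ is a new predicate, and extend this to sets of atoms. A *specialization* of a tuple of variables $\bar x=(x_1,\dots,x_n)$ is a function $f:\bar x\to\bar x$ with $f(x_1)=x_1$ and $f(x_i)\in\{f(x_1),\dots,f(x_{i-1}),x_i\}$ for $i\ge 2$. For a set $\Sigma$ of linear TGDs, $\mathsf{simple}(\Sigma)$ consists of the TGDs $\mathsf{simple}(R(f(\bar x)))\to\exists\bar z\,\mathsf{simple}(\psi(f(\bar y),\bar z))$, for $R(\bar x)\to\exists\bar z\,\psi(\bar y,\bar z)$ in $\Sigma$ and $f$ a specialization of $\bar x$. **Theorem.** Let $D$ be a database and $\Sigma$ a finite set of linear TGDs, no two of which share a variable. All valid chase derivations of $D$ w.r.t. $\Sigma$ have the same result, denoted $\mathsf{chase}(D,\Sigma)$, and at least one such derivation exists. Moreover, with $$\mathsf d_{\mathsf L}(\Sigma)=|\mathsf{sch}(\Sigma)|\cdot\mathsf{ar}(\Sigma)^{\mathsf{ar}(\Sigma)+1},\qquad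 f_{\mathsf L}(\Sigma)=(\mathsf d_{\mathsf L}(\Sigma)+1)\cdot\|\Sigma\|^{\,2\cdot\mathsf{ar}(\Sigma)\cdot(\mathsf d_{\mathsf L}(\Sigma)+1)}$$ (where $0^0=1$), the following are equivalent: 1. $\Sigma\in\mathsf{CT}_D$; that is, each of the following equivalent conditions holds: (a) every valid chase derivation of $D$ w.r.t. $\Sigma$ is finite; (b) some valid chase derivation of $D$ w.r.t. $\Sigma$ is finite; (c) $\mathsf{chase}(D,\Sigma)$ is finite. 2. $|\mathsf{chase}(D,\Sigma)|\le|D|\cdot f_{\mathsf L}(\Sigma)$. 3. $\mathsf{simple}(\Sigma)$ is $\mathsf{simple}(D)$-weakly-acyclic. -/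

import Mathlib

universe u

namespace ChaseTGD

/-! ### Schemas, atoms and tuple-generating dependencies -/

/-- The countably infinite set of variables. -/
abbrev Var : Type := ℕ

/-- The countably infinite set of constants (a different sort from the variables and the nulls,
so that the three sets are disjoint). -/
abbrev Const : Type := ℕ

/-- A supply of relation symbols, each with a positive arity. -/
structure Signature where
  Pred : Type u
  arity : Pred → ℕ
  arity_pos : ∀ R, 0 < arity R

/-- An atom `R(t₁,…,tₙ)` whose arguments are terms from `T`. -/
@[ext]
structure Atom (S : Signature.{u}) (T : Type*) where
  pred : S.Pred
  args : Fin (S.arity pred) → T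

/-- The atom `R(f(t₁),…,f(tₙ))`. -/
def Atom.map {S : Signature.{u}} {T U : Type*} (f : T → U) (a : Atom S T) : Atom S U where
  pred := a.pred
  args := fun i => f (a.args i)

/-- The variables of an atom. -/
def Atom.vars {S : Signature.{u}} (a : Atom S Var) : Set Var := Set.range a.args

/-- A (constant-free) tuple-generating dependency `φ(x̄,ȳ) → ∃ z̄ ψ(x̄,z̄)`; the non-empty
conjunctions `φ` (body) and `ψ` (head) are treated as finite sets of atoms. The variables `x̄` are
those common to body and head, and `z̄` are the variables that occur in the head only. -/
@[ext]
structure TGD (S : Signature.{u}) where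
  body : Finset (Atom S Var)
  head : Finset (Atom S Var)
  body_nonempty : body.Nonempty
  head_nonempty : head.Nonempty

namespace TGD

variable {S : Signature.{u}}

def bodyVars (σ : TGD S) : Set Var := {x | ∃ a ∈ σ.body, x ∈ a.vars}

def headVars (σ : TGD S) : Set Var := {x | ∃ a ∈ σ.head, x ∈ a.vars}

def vars (σ : TGD S) : Set Var := σ.bodyVars ∪ σ.headVars

/-- The frontier: the variables that occur both in the body and in the head. -/
def frontier (σ : TGD S) : Set Var := σ.bodyVars ∩ σ.headVars

/-- The existentially quantified variables. -/
def exVars (σ : TGD S) : Set Var := σ.headVars \ σ.bodyVars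

/-- A TGD is linear if it has only one atom in its body. -/
def IsLinear (σ : TGD S) : Prop := σ.body.card = 1

end TGD

/-! ### The semi-oblivious chase -/

/-- The terms that may occur in an instance: constants and labelled nulls. The null
`null σ z h` is `⊥_{σ,h}^z`, where `h` assigns a term to every frontier variable of `σ`; its name is
thus uniquely determined by `σ`, `h` and `z`. -/
inductive GTerm (S : Signature.{u}) : Type u
  | const (c : Const) : GTerm S
  | null (σ : TGD S) (z : Var) (h : {x : Var // x ∈ σ.frontier} → GTerm S) : GTerm S

/-- A fact is an atom whose arguments are constants. A database is a finite set of facts. -/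
abbrev Fact (S : Signature.{u}) : Type u := Atom S Const

/-- An instance is a (possibly infinite) set of atoms over constants and nulls. -/
abbrev Instance (S : Signature.{u}) : Type u := Set (Atom S (GTerm S))

section Chase

variable {S : Signature.{u}}

/-- A set of facts, seen as an instance. -/
def toInstance (D : Set (Fact S)) : Instance S := Atom.map GTerm.const '' D

open Classical in
/-- The assignment `μ` that extends `h` on the frontier by the nulls of the trigger `(σ,h)`. -/
noncomputable def extend (σ : TGD S) (h : Var → GTerm S) : Var → GTerm S := fun x =>
  if x ∈ σ.frontier then h x else GTerm.null σ x (fun y => h y.1)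

/-- The result `μ(head(σ))` of the trigger `(σ,h)`. -/
def result (σ : TGD S) (h : Var → GTerm S) : Instance S :=
  {b | ∃ a ∈ σ.head, b = a.map (extend σ h)}

/-- `(σ,h)` is a trigger for `Γ` on `I`: `σ ∈ Γ`, and `h` is a homomorphism from the body of `σ`
to `I`. (Only the values of `h` on the variables of the body play a role.) -/
def IsTrigger (Γ : Set (TGD S)) (I : Instance S) (σ : TGD S) (h : Var → GTerm S) : Prop :=
  σ ∈ Γ ∧ ∀ a ∈ σ.body, a.map h ∈ I

/-- A trigger on `I` is active if its result is not contained in `I`. -/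
def IsActive (Γ : Set (TGD S)) (I : Instance S) (σ : TGD S) (h : Var → GTerm S) : Prop :=
  IsTrigger Γ I σ h ∧ ¬ result σ h ⊆ I

/-- `J` is obtained from `I` by the application of an active trigger. -/
def ChaseStep (Γ : Set (TGD S)) (I J : Instance S) : Prop :=
  ∃ σ h, IsActive Γ I σ h ∧ J = I ∪ result σ h

/-- The sequence `I₀,…,Iₙ` is a finite chase derivation of `D` w.r.t. `Γ`. -/
def IsFiniteDerivation (D : Set (Fact S)) (Γ : Set (TGD S)) (n : ℕ)
    (I : Fin (n + 1) → Instance S) : Prop :=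
  I 0 = toInstance D ∧
  (∀ i : Fin n, ChaseStep Γ (I i.castSucc) (I i.succ)) ∧
  ∀ σ h, ¬ IsActive Γ (I (Fin.last n)) σ h

/-- The sequence `I₀,I₁,…` is an infinite chase derivation of `D` w.r.t. `Γ`. -/
def IsInfiniteDerivation (D : Set (Fact S)) (Γ : Set (TGD S)) (I : ℕ → Instance S) : Prop :=
  I 0 = toInstance D ∧ ∀ i, ChaseStep Γ (I i) (I (i + 1))

/-- Fairness: no trigger remains active forever. -/
def IsFair (Γ : Set (TGD S)) (I : ℕ → Instance S) : Prop :=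
  ∀ i σ h, IsActive Γ (I i) σ h → ∃ j > i, ¬ IsActive Γ (I j) σ h

/-- `J` is the result of a valid chase derivation of `D` w.r.t. `Γ`, that is, of a finite one, or
of an infinite and fair one. -/
def IsChaseResult (D : Set (Fact S)) (Γ : Set (TGD S)) (J : Instance S) : Prop :=
  (∃ n I, IsFiniteDerivation D Γ n I ∧ J = I (Fin.last n)) ∨
  (∃ I, IsInfiniteDerivation D Γ I ∧ IsFair Γ I ∧ J = ⋃ i, I i)

/-- `chase(D,Γ)`: the common result of the valid chase derivations of `D` w.r.t. `Γ`. -/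
noncomputable def chase (D : Set (Fact S)) (Γ : Set (TGD S)) : Instance S :=
  Classical.epsilon (IsChaseResult D Γ)

/-- The sets of TGDs such that every valid chase derivation of `D` is finite. -/
def CTForall (D : Set (Fact S)) : Set (Set (TGD S)) :=
  {Γ | ¬ ∃ I, IsInfiniteDerivation D Γ I ∧ IsFair Γ I}

/-- The sets of TGDs such that some valid chase derivation of `D` is finite. -/
def CTExists (D : Set (Fact S)) : Set (Set (TGD S)) :=
  {Γ | ∃ n I, IsFiniteDerivation D Γ n I}

end Chase

/-! ### The size of a set of TGDs and the bound on the size of the chase -/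

section Size

variable {S : Signature.{u}}

/-- The set of atoms that occur in the TGDs of `Γ`. -/
def atoms (Γ : Set (TGD S)) : Set (Atom S Var) := {a | ∃ σ ∈ Γ, a ∈ σ.body ∨ a ∈ σ.head}

/-- The schema of `Γ`: the set of predicates that occur in `Γ`. -/
def sch (Γ : Set (TGD S)) : Set S.Pred := Atom.pred '' atoms Γ

/-- The maximum arity of the predicates of `Γ` (and `0` if `Γ` is empty). -/
noncomputable def maxArity (Γ : Set (TGD S)) : ℕ := sSup (S.arity '' sch Γ)

/-- `‖Γ‖ = |atoms(Γ)| · |sch(Γ)| · ar(Γ)`. -/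
noncomputable def size (Γ : Set (TGD S)) : ℕ :=
  (atoms Γ).ncard * (sch Γ).ncard * maxArity Γ

/-- `d_L(Γ) = |sch(Γ)| · ar(Γ)^(ar(Γ)+1)`. -/
noncomputable def depthBound (Γ : Set (TGD S)) : ℕ :=
  (sch Γ).ncard * maxArity Γ ^ (maxArity Γ + 1)

/-- `f_L(Γ) = (d_L(Γ)+1) · ‖Γ‖^(2 · ar(Γ) · (d_L(Γ)+1))`. -/
noncomputable def sizeBound (Γ : Set (TGD S)) : ℕ :=
  (depthBound Γ + 1) * size Γ ^ (2 * maxArity Γ * (depthBound Γ + 1))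

end Size

/-! ### Non-uniform weak-acyclicity -/

section WeakAcyclicity

variable {S : Signature.{u}}

/-- A position `(R,i)`. -/
abbrev Position (S : Signature.{u}) : Type u := Σ R : S.Pred, Fin (S.arity R)

/-- The set `pos(a,x)` of the positions of the atom `a` at which `x` occurs. -/
def Atom.pos (a : Atom S Var) (x : Var) : Set (Position S) :=
  {π | ∃ i, π = ⟨a.pred, i⟩ ∧ a.args i = x}

/-- The normal edges of the dependency graph of `Γ`. -/
def NormalEdge (Γ : Set (TGD S)) (π π' : Position S) : Prop :=
  ∃ σ ∈ Γ, ∃ x ∈ σ.frontier, (∃ a ∈ σ.body, π ∈ a.pos x) ∧ ∃ b ∈ σ.head, π' ∈ b.pos x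

/-- The special edges of the dependency graph of `Γ`. -/
def SpecialEdge (Γ : Set (TGD S)) (π π' : Position S) : Prop :=
  ∃ σ ∈ Γ, ∃ x ∈ σ.frontier, (∃ a ∈ σ.body, π ∈ a.pos x) ∧
    ∃ z ∈ σ.exVars, ∃ b ∈ σ.head, π' ∈ b.pos z

/-- `R →_Γ P`: both are predicates of `Γ`, and `R = P`, or some TGD of `Γ` has `R` in its body and
`P` in its head. -/
def PredArrow (Γ : Set (TGD S)) (R P : S.Pred) : Prop :=
  R ∈ sch Γ ∧ P ∈ sch Γ ∧
    (R = P ∨ ∃ σ ∈ Γ, (∃ a ∈ σ.body, a.pred = R) ∧ ∃ b ∈ σ.head, b.pred = P)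

/-- `P` is reachable from `R` w.r.t. `Γ`. -/
def Reachable (Γ : Set (TGD S)) (R P : S.Pred) : Prop := Relation.TransGen (PredArrow Γ) R P

/-- `Γ` is `D`-weakly-acyclic: the dependency graph of `Γ` has no cycle `c₀,c₁,…,cₙ = c₀` (not
necessarily simple) that has a special edge and is `D`-supported, that is, has a node `(P,i)` such
that `P` is reachable from the predicate of some fact of `D`. -/
def WeaklyAcyclic (D : Set (Fact S)) (Γ : Set (TGD S)) : Prop :=
  ¬ ∃ (n : ℕ) (c : ℕ → Position S), c n = c 0 ∧
    (∀ i < n, NormalEdge Γ (c i) (c (i + 1)) ∨ SpecialEdge Γ (c i) (c (i + 1))) ∧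
    (∃ i < n, SpecialEdge Γ (c i) (c (i + 1))) ∧
    (∃ i ≤ n, ∃ a ∈ D, Reachable Γ a.pred (c i).1)

end WeakAcyclicity

/-! ### Simplification -/

section Tuples

variable {n : ℕ} {T : Type*} [DecidableEq T]

/-- The positions of the tuple `t` that hold the first occurrence of a term. -/
def firsts (t : Fin n → T) : Finset (Fin n) := Finset.univ.filter fun i => ∀ j < i, t j ≠ t i

/-- `unique(t)`: the tuple obtained from `t` by keeping only the first occurrence of each term. -/
def unique (t : Fin n → T) : Fin (firsts t).card → T :=
  fun k => t ((firsts t).orderEmbOfFin rfl k)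

/-- `id_t(tᵢ)`: the position (counted from `1`) of `unique(t)` at which `tᵢ` appears, that is, the
number of first occurrences up to and including the first occurrence of `tᵢ`. -/
def ident (t : Fin n → T) (i : Fin n) : ℕ :=
  ((firsts t).filter fun j => ∃ k ∈ firsts t, t k = t i ∧ j ≤ k).card

end Tuples

theorem exists_first {n : ℕ} {T : Type*} [DecidableEq T] (t : Fin n → T) (i : Fin n) :
    ∃ k ∈ firsts t, t k = t i ∧ k ≤ i := by
  classical
  have hne : (Finset.univ.filter fun j => t j = t i).Nonempty := ⟨i, by simp⟩
  obtain ⟨k, hk, hmin⟩ := Finset.exists_min_image _ id hne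
  simp only [Finset.mem_filter, Finset.mem_univ, true_and, id] at hk hmin
  refine ⟨k, ?_, hk, hmin i rfl⟩
  simp only [firsts, Finset.mem_filter, Finset.mem_univ, true_and]
  intro j hj he
  exact absurd (hmin j (he.trans hk)) (not_le.mpr hj)

theorem first_unique {n : ℕ} {T : Type*} [DecidableEq T] (t : Fin n → T) {k l : Fin n}
    (hk : k ∈ firsts t) (hl : l ∈ firsts t) (h : t k = t l) : k = l := by
  simp only [firsts, Finset.mem_filter, Finset.mem_univ, true_and] at hk hl
  rcases lt_trichotomy k l with h' | h' | h'
  · exact absurd h (hl k h')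
  · exact h'
  · exact absurd h.symm (hk l h')

theorem ident_of_first {n : ℕ} {T : Type*} [DecidableEq T] (t : Fin n → T) {i k : Fin n}
    (hk : k ∈ firsts t) (h : t k = t i) :
    ident t i = ((firsts t).filter fun j => j ≤ k).card := by
  unfold ident
  congr 1
  ext j
  simp only [Finset.mem_filter, and_congr_right_iff]
  intro _
  constructor
  · rintro ⟨l, hl, hl', hj⟩
    rwa [first_unique t hk hl (h.trans hl'.symm)]
  · intro hj
    exact ⟨k, hk, h, hj⟩

/-- `id(t)` has the same equalities between its components as `t`. -/
theorem ident_eq_iff {n : ℕ} {T : Type*} [DecidableEq T] (t : Fin n → T) (i j : Fin n) :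
    ident t i = ident t j ↔ t i = t j := by
  obtain ⟨k, hk, hki, -⟩ := exists_first t i
  obtain ⟨l, hl, hlj, -⟩ := exists_first t j
  rw [ident_of_first t hk hki, ident_of_first t hl hlj, ← hki, ← hlj]
  constructor
  · intro h
    rcases le_total k l with hkl | hkl
    · have := Finset.eq_of_subset_of_card_le
        (Finset.monotone_filter_right (firsts t) (fun x _ hx => le_trans hx hkl :
          ∀ x ∈ firsts t, x ≤ k → x ≤ l)) h.ge
      have hm : l ∈ (firsts t).filter fun x => x ≤ k := by
        rw [this]; simp [hl]
      rw [le_antisymm hkl (Finset.mem_filter.mp hm).2]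
    · have := Finset.eq_of_subset_of_card_le
        (Finset.monotone_filter_right (firsts t) (fun x _ hx => le_trans hx hkl :
          ∀ x ∈ firsts t, x ≤ l → x ≤ k)) h.le
      have hm : k ∈ (firsts t).filter fun x => x ≤ l := by
        rw [this]; simp [hk]
      rw [le_antisymm hkl (Finset.mem_filter.mp hm).2]
  · intro h
    rw [first_unique t hk hl h]

theorem firsts_ident {n : ℕ} {T : Type*} [DecidableEq T] (t : Fin n → T) :
    firsts (ident t) = firsts t := by
  ext i
  simp [firsts, ident_eq_iff]

theorem firsts_card_pos {n : ℕ} {T : Type*} [DecidableEq T] (t : Fin n → T) (hn : 0 < n) :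
    0 < (firsts t).card := by
  obtain ⟨k, hk, -⟩ := exists_first t ⟨0, hn⟩
  exact Finset.card_pos.mpr ⟨k, hk⟩

section Simplification

variable {S : Signature.{u}}

/-- A predicate `R_ℓ`, where `ℓ` is a tuple of integers of the length `ar(R)`. -/
structure SimplePred (S : Signature.{u}) where
  base : S.Pred
  ids : Fin (S.arity base) → ℕ

/-- The predicates `R_ℓ`; the arity of `R_ℓ` is the number of distinct components of `ℓ`. -/
def Signature.simple (S : Signature.{u}) : Signature.{u} where
  Pred := SimplePred S
  arity := fun R => (firsts R.ids).card
  arity_pos := fun R => firsts_card_pos R.ids (S.arity_pos R.base)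

/-- The simplification `R_{id(t)}(unique(t))` of the atom `R(t)`. -/
def Atom.simple {T : Type*} [DecidableEq T] (a : Atom S T) : Atom S.simple T where
  pred := ⟨a.pred, ident a.args⟩
  args := fun k => unique a.args (Fin.cast (congrArg Finset.card (firsts_ident a.args)) k)

/-- `f` is a specialization of the tuple of variables `(x₁,…,xₙ)`: it holds that `f(x₁) = x₁`, and
`f(xᵢ) ∈ {f(x₁),…,f(xᵢ₋₁),xᵢ}` for `i > 1`. It is extended by the identity to all variables. -/
def IsSpecialization {n : ℕ} (x : Fin n → Var) (f : Var → Var) : Prop :=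
  (∀ i, f (x i) = x i ∨ ∃ j < i, f (x i) = f (x j)) ∧ ∀ y, y ∉ Set.range x → f y = y

open Classical in
/-- The TGD obtained from `σ` by applying `f` to its variables and simplifying all atoms. -/
noncomputable def TGD.simplify (σ : TGD S) (f : Var → Var) : TGD S.simple where
  body := σ.body.image fun a => (a.map f).simple
  head := σ.head.image fun a => (a.map f).simple
  body_nonempty := σ.body_nonempty.image _
  head_nonempty := σ.head_nonempty.image _

/-- The set `simple(σ)` of the simplifications of the linear TGD `σ`, with body atom `R(x̄)`, that
are induced by the specializations of `x̄`. -/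
def TGD.simple (σ : TGD S) : Set (TGD S.simple) :=
  {τ | ∃ a ∈ σ.body, ∃ f, IsSpecialization a.args f ∧ τ = σ.simplify f}

/-- `simple(Γ)`. -/
def simpleTGDs (Γ : Set (TGD S)) : Set (TGD S.simple) := ⋃ σ ∈ Γ, σ.simple

/-- `simple(D)`. -/
def simpleDB (D : Set (Fact S)) : Set (Fact S.simple) := Atom.simple '' D

end Simplification

end ChaseTGD

/-! A trigger of a linear TGD reads a single atom. Hence every valid chase derivation of `D`
produces the same set, `derivable D Γ`: the atoms reachable from facts of `D` along single-atom
steps `Succ`. It is the least instance that contains `D` and is closed under `Γ`. A fair derivation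
exists because only countably many trigger results matter. If `derivable D Γ` is finite, no infinite
derivation exists, since each step adds an atom.

The link with weak-acyclicity is that simplification loses nothing: the predicate of a simplified
atom (its shape) records which arguments coincide, and a specialization records which body variables
a homomorphism identifies. Since a fresh null is strictly deeper than the terms it depends on, it
equals none of them, so the simplified head atoms have exactly the shapes of the atoms that the
trigger creates (`Agrees.apply_eq_iff_extend`). Triggers of `Γ` and edges of the dependency graph of
`simpleTGDs Γ` therefore match in both directions.

If the chase is finite, no supported cycle has a special edge: the cycle could be followed by
derivable atoms, and each turn would raise the depth of a null
(`weaklyAcyclic_of_derivable_finite`). Conversely, under weak-acyclicity the positions at which the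
depth of a term grew are pairwise distinct, so depth is bounded by the number of positions of the
simplified schema, which is at most `depthBound Γ` (`exists_finset_depth_le`,
`exists_positions_card_le`).

Bounded depth yields the size bound although derivations may be much longer than the depth. All
arguments of a derivable atom lie in one tuple of a tree of bags whose levels are indexed by depth
rather than by derivation length (`exists_bag`); counting bags level by level gives `sizeBound Γ`
atoms per fact (`exists_finset_bags`, `exists_finset_derivable_from`). -/

namespace ChaseTGD

/-! ### The chase of linear TGDs as reachability between atoms; existence of fair derivations. -/

section LinearChase

variable {S : Signature.{u}}

/-- The atom `β` belongs to the result of a trigger whose body is mapped to the single atom `δ`. -/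
def Succ (Γ : Set (TGD S)) (δ β : Atom S (GTerm S)) : Prop :=
  ∃ σ ∈ Γ, ∃ h : Var → GTerm S, (∀ a ∈ σ.body, a.map h = δ) ∧
    ∃ b ∈ σ.head, β = b.map (extend σ h)

/-- The atoms that can be derived from a database by linear TGDs. -/
def derivable (D : Set (Fact S)) (Γ : Set (TGD S)) : Instance S :=
  {β | ∃ α ∈ toInstance D, Relation.ReflTransGen (Succ Γ) α β}

theorem TGD.IsLinear.exists_body {σ : TGD S} (h : σ.IsLinear) : ∃ a, σ.body = {a} :=
  Finset.card_eq_one.mp h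

/-- An instance is closed under a set of TGDs if no trigger on it is active. -/
def IsClosedUnder (Γ : Set (TGD S)) (I : Instance S) : Prop :=
  ∀ σ h, IsTrigger Γ I σ h → result σ h ⊆ I

theorem isClosedUnder_of_not_active {Γ : Set (TGD S)} {I : Instance S}
    (h : ∀ σ g, ¬ IsActive Γ I σ g) : IsClosedUnder Γ I := fun σ g ht => by
  by_contra hc
  exact h σ g ⟨ht, hc⟩

theorem derivable_closed {D : Set (Fact S)} {Γ : Set (TGD S)}
    (hlin : ∀ σ ∈ Γ, σ.IsLinear) : IsClosedUnder Γ (derivable D Γ) := by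
  rintro σ h ⟨hσ, hbody⟩ β ⟨b, hb, rfl⟩
  obtain ⟨a, ha⟩ := (hlin σ hσ).exists_body
  obtain ⟨α, hα, hαδ⟩ := hbody a (by simp [ha])
  exact ⟨α, hα, hαδ.tail ⟨σ, hσ, h, by simp [ha], b, hb, rfl⟩⟩

theorem derivable_subset {D : Set (Fact S)} {Γ : Set (TGD S)} {I : Instance S}
    (hD : toInstance D ⊆ I) (hI : IsClosedUnder Γ I) : derivable D Γ ⊆ I := by
  rintro β ⟨α, hα, hαβ⟩
  induction hαβ with
  | refl => exact hD hα
  | tail _ hs ih =>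
    obtain ⟨σ, hσ, h, hbody, b, hb, rfl⟩ := hs
    exact hI σ h ⟨hσ, fun a ha => by rw [hbody a ha]; exact ih⟩ ⟨b, hb, rfl⟩

theorem ChaseStep.subset {Γ : Set (TGD S)} {I J : Instance S} (h : ChaseStep Γ I J) : I ⊆ J := by
  obtain ⟨σ, g, -, rfl⟩ := h
  exact Set.subset_union_left

theorem ChaseStep.ne {Γ : Set (TGD S)} {I J : Instance S} (h : ChaseStep Γ I J) : I ≠ J := by
  obtain ⟨σ, g, ⟨-, h⟩, rfl⟩ := h
  intro he
  exact h (Set.union_eq_left.mp he.symm)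

theorem ChaseStep.subset_closed {Γ : Set (TGD S)} {I J K : Instance S} (h : ChaseStep Γ I J)
    (hK : IsClosedUnder Γ K) (hI : I ⊆ K) : J ⊆ K := by
  obtain ⟨σ, g, ⟨⟨hσ, hb⟩, -⟩, rfl⟩ := h
  exact Set.union_subset hI (hK σ g ⟨hσ, fun a ha => hI (hb a ha)⟩)

theorem result_finite (σ : TGD S) (h : Var → GTerm S) : (result σ h).Finite := by
  have : result σ h = (fun a : Atom S Var => a.map (extend σ h)) '' (σ.head : Set (Atom S Var)) := by
    ext b
    simp only [result, Set.mem_ofPred_eq, Set.mem_image, Finset.mem_coe, eq_comm]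
  rw [this]
  exact σ.head.finite_toSet.image _

theorem ChaseStep.finite {Γ : Set (TGD S)} {I J : Instance S} (h : ChaseStep Γ I J)
    (hI : I.Finite) : J.Finite := by
  obtain ⟨σ, g, -, rfl⟩ := h
  exact hI.union (result_finite σ g)

theorem IsInfiniteDerivation.monotone {D : Set (Fact S)} {Γ : Set (TGD S)} {I : ℕ → Instance S}
    (h : IsInfiniteDerivation D Γ I) : Monotone I :=
  monotone_nat_of_le_succ fun i => (h.2 i).subset

theorem IsInfiniteDerivation.strictMono {D : Set (Fact S)} {Γ : Set (TGD S)} {I : ℕ → Instance S}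
    (h : IsInfiniteDerivation D Γ I) : StrictMono I :=
  strictMono_nat_of_lt_succ fun i => lt_of_le_of_ne (h.2 i).subset (h.2 i).ne

theorem IsInfiniteDerivation.subset_derivable {D : Set (Fact S)} {Γ : Set (TGD S)}
    (hlin : ∀ σ ∈ Γ, σ.IsLinear) {I : ℕ → Instance S}
    (h : IsInfiniteDerivation D Γ I) (i : ℕ) : I i ⊆ derivable D Γ := by
  induction i with
  | zero => rw [h.1]; exact fun α hα => ⟨α, hα, .refl⟩
  | succ i ih => exact (h.2 i).subset_closed (derivable_closed hlin) ih

theorem IsFiniteDerivation.eq_derivable {D : Set (Fact S)} {Γ : Set (TGD S)}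
    (hlin : ∀ σ ∈ Γ, σ.IsLinear) {n : ℕ} {I : Fin (n + 1) → Instance S}
    (h : IsFiniteDerivation D Γ n I) : I (Fin.last n) = derivable D Γ := by
  apply subset_antisymm
  · have : ∀ i, I i ⊆ derivable D Γ := by
      intro i
      induction i using Fin.induction with
      | zero => rw [h.1]; exact fun α hα => ⟨α, hα, .refl⟩
      | succ i ih => exact (h.2.1 i).subset_closed (derivable_closed hlin) ih
    exact this _
  · refine derivable_subset ?_ (isClosedUnder_of_not_active h.2.2)
    have : ∀ i, toInstance D ⊆ I i := by
      intro i
      induction i using Fin.induction with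
      | zero => rw [h.1]
      | succ i ih => exact ih.trans (h.2.1 i).subset
    exact this _

theorem IsFiniteDerivation.finite {D : Set (Fact S)} (hD : D.Finite) {Γ : Set (TGD S)} {n : ℕ}
    {I : Fin (n + 1) → Instance S} (h : IsFiniteDerivation D Γ n I) (i : Fin (n + 1)) :
    (I i).Finite := by
  induction i using Fin.induction with
  | zero => rw [h.1]; exact hD.image _
  | succ i ih => exact (h.2.1 i).finite ih

theorem IsInfiniteDerivation.eq_derivable {D : Set (Fact S)} {Γ : Set (TGD S)}
    (hlin : ∀ σ ∈ Γ, σ.IsLinear) {I : ℕ → Instance S}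
    (h : IsInfiniteDerivation D Γ I) (hfair : IsFair Γ I) : ⋃ i, I i = derivable D Γ := by
  apply subset_antisymm
  · exact Set.iUnion_subset (h.subset_derivable hlin)
  · refine derivable_subset (fun α hα => Set.mem_iUnion.mpr ⟨0, by rw [h.1]; exact hα⟩) ?_
    rintro σ g ⟨hσ, hb⟩
    obtain ⟨a, ha⟩ := (hlin σ hσ).exists_body
    obtain ⟨i, hi⟩ := Set.mem_iUnion.mp (hb a (by simp [ha]))
    -- Once the only body atom is present, the trigger persists, so it can stop being active only
    -- because its result has been added.
    have key : ∀ j ≥ i, IsTrigger Γ (I j) σ g := fun j hj =>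
      ⟨hσ, by simpa [ha] using h.monotone hj hi⟩
    have : ∃ j ≥ i, ¬ IsActive Γ (I j) σ g := by
      by_cases hact : IsActive Γ (I i) σ g
      · obtain ⟨j, hj, hn⟩ := hfair i σ g hact
        exact ⟨j, hj.le, hn⟩
      · exact ⟨i, le_rfl, hact⟩
    obtain ⟨j, hj, hn⟩ := this
    have hres : result σ g ⊆ I j := by
      by_contra hc
      exact hn ⟨key j hj, hc⟩
    exact hres.trans (Set.subset_iUnion I j)

theorem IsChaseResult.eq_derivable {D : Set (Fact S)} {Γ : Set (TGD S)}
    (hlin : ∀ σ ∈ Γ, σ.IsLinear) {J : Instance S} (h : IsChaseResult D Γ J) :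
    J = derivable D Γ := by
  rcases h with ⟨n, I, hI, rfl⟩ | ⟨I, hI, hf, rfl⟩
  · exact hI.eq_derivable hlin
  · exact hI.eq_derivable hlin hf

theorem extend_congr {σ : TGD S} {h g : Var → GTerm S} (hg : ∀ x ∈ σ.frontier, h x = g x) :
    extend σ h = extend σ g := by
  funext x
  unfold extend
  have : (fun y : {x : Var // x ∈ σ.frontier} => h y.1) = fun y => g y.1 :=
    funext fun y => hg y.1 y.2
  rw [this]
  split_ifs with hx
  · exact hg x hx
  · rfl

theorem result_congr_body {σ : TGD S} {a : Atom S Var} (ha : σ.body = {a})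
    {h g : Var → GTerm S} (hg : a.map h = a.map g) : result σ h = result σ g := by
  have : extend σ h = extend σ g := by
    apply extend_congr
    rintro x ⟨⟨a', ha', i, rfl⟩, -⟩
    rw [ha, Finset.mem_singleton] at ha'
    subst ha'
    simp only [Atom.map, Atom.mk.injEq, heq_eq_eq, true_and] at hg
    exact congrFun hg i
  unfold result
  rw [this]

/-- The results of the triggers on an instance. -/
def triggerResults (Γ : Set (TGD S)) (I : Instance S) : Set (Instance S) :=
  {R | ∃ σ h, IsTrigger Γ I σ h ∧ R = result σ h}

/-- There are uncountably many assignments `h`, but the result depends only on the TGD and on the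
image of its body atom, so any homomorphism with that image can represent it. -/
theorem triggerResults_countable {Γ : Set (TGD S)} (hΓ : Γ.Finite)
    (hlin : ∀ σ ∈ Γ, σ.IsLinear) {I : Instance S} (hI : I.Countable) :
    (triggerResults Γ I).Countable := by
  classical
  let F : TGD S → Atom S (GTerm S) → Instance S := fun σ δ =>
    if hh : ∃ h : Var → GTerm S, ∀ a ∈ σ.body, a.map h = δ then result σ hh.choose else ∅
  refine (hΓ.countable.biUnion (fun σ _ => hI.image (F σ))).mono ?_
  rintro R ⟨σ, h, ⟨hσ, hb⟩, rfl⟩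
  obtain ⟨a, ha⟩ := (hlin σ hσ).exists_body
  have hh : ∃ g : Var → GTerm S, ∀ a' ∈ σ.body, a'.map g = a.map h := ⟨h, by simp [ha]⟩
  refine Set.mem_biUnion hσ ⟨a.map h, hb a (by simp [ha]), ?_⟩
  simp only [F, dif_pos hh]
  exact result_congr_body ha (hh.choose_spec a (by simp [ha]))

/-- The signature may be uncountable, so countability comes from saturating `D` in countably many
stages, each adding countably many finite results. -/
theorem derivable_countable {D : Set (Fact S)} (hD : D.Finite) {Γ : Set (TGD S)}
    (hΓ : Γ.Finite) (hlin : ∀ σ ∈ Γ, σ.IsLinear) : (derivable D Γ).Countable := by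
  let stage : ℕ → Instance S := fun n =>
    n.rec (toInstance D) fun _ I => I ∪ ⋃₀ triggerResults Γ I
  have hs : ∀ n, (stage n).Countable := by
    intro n
    induction n with
    | zero => exact (hD.image _).countable
    | succ n ih =>
      refine ih.union ((triggerResults_countable hΓ hlin ih).sUnion ?_)
      rintro R ⟨σ, h, -, rfl⟩
      exact (result_finite σ h).countable
  refine (Set.countable_iUnion hs).mono (derivable_subset
    (fun α hα => Set.mem_iUnion.mpr ⟨0, hα⟩) ?_)
  rintro σ h ⟨hσ, hb⟩ β hβ
  obtain ⟨a, ha⟩ := (hlin σ hσ).exists_body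
  obtain ⟨n, hn⟩ := Set.mem_iUnion.mp (hb a (by simp [ha]))
  exact Set.mem_iUnion.mpr ⟨n + 1, Or.inr ⟨result σ h, ⟨σ, h, ⟨hσ, by simpa [ha] using hn⟩, rfl⟩, hβ⟩⟩

theorem triggerResults_mono {Γ : Set (TGD S)} {I J : Instance S} (h : I ⊆ J) :
    triggerResults Γ I ⊆ triggerResults Γ J := by
  rintro R ⟨σ, g, ⟨hσ, hb⟩, rfl⟩
  exact ⟨σ, g, ⟨hσ, fun a ha => h (hb a ha)⟩, rfl⟩

/-- Number all trigger results on `derivable D Γ` and always add the active one of least number. A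
trigger active forever would bound the numbers of infinitely many distinct results. -/
theorem exists_isChaseResult {D : Set (Fact S)} (hD : D.Finite) {Γ : Set (TGD S)}
    (hΓ : Γ.Finite) (hlin : ∀ σ ∈ Γ, σ.IsLinear) : ∃ J, IsChaseResult D Γ J := by
  classical
  obtain ⟨idx, hidx⟩ := Set.countable_iff_exists_injOn.mp
    (triggerResults_countable hΓ hlin (derivable_countable hD hΓ hlin))
  let act : Instance S → Set (Instance S) := fun I => {R | R ∈ triggerResults Γ I ∧ ¬ R ⊆ I}
  have hmin : ∀ I, (act I).Nonempty → ∃ R ∈ act I, ∀ R' ∈ act I, idx R ≤ idx R' := by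
    intro I hI
    refine ⟨Function.argminOn idx (act I) hI, Function.argminOn_mem _ _ _, fun R' hR' => ?_⟩
    exact Function.argminOn_le idx (act I) hR'
  let next : Instance S → Instance S := fun I =>
    if hI : (act I).Nonempty then I ∪ (hmin I hI).choose else I
  let J : ℕ → Instance S := fun n => n.rec (toInstance D) fun _ I => next I
  have hJ : ∀ n, J (n + 1) = next (J n) := fun n => rfl
  have hstep : ∀ n, (act (J n)).Nonempty → ∃ R ∈ act (J n),
      (∀ R' ∈ act (J n), idx R ≤ idx R') ∧ J (n + 1) = J n ∪ R := by
    intro n hn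
    refine ⟨(hmin _ hn).choose, (hmin _ hn).choose_spec.1, (hmin _ hn).choose_spec.2, ?_⟩
    rw [hJ]
    simp only [next, dif_pos hn]
  have hchase : ∀ n, (act (J n)).Nonempty → ChaseStep Γ (J n) (J (n + 1)) := by
    intro n hn
    obtain ⟨R, ⟨⟨σ, h, ht, rfl⟩, hR⟩, -, he⟩ := hstep n hn
    exact ⟨σ, h, ⟨ht, hR⟩, he⟩
  by_cases hall : ∀ n, (act (J n)).Nonempty
  · have hinf : IsInfiniteDerivation D Γ J := ⟨rfl, fun i => hchase i (hall i)⟩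
    refine ⟨_, Or.inr ⟨J, hinf, ?_, rfl⟩⟩
    intro i σ h hact
    by_contra! hc
    choose R hRact hRmin hRJ using fun n => hstep n (hall n)
    have hRd : ∀ n, R n ∈ triggerResults Γ (derivable D Γ) := fun n =>
      triggerResults_mono (hinf.subset_derivable hlin n) (hRact n).1
    have hle : ∀ k, idx (R (i + 1 + k)) ≤ idx (result σ h) := fun k =>
      hRmin _ _ ⟨⟨σ, h, (hc _ (by omega)).1, rfl⟩, (hc _ (by omega)).2⟩
    -- A result, once added, is contained in all later instances and so is never chosen again.
    have hRinj : Function.Injective R := by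
      intro m n hmn
      by_contra hne
      wlog hlt : m < n generalizing m n with H
      · exact H hmn.symm (Ne.symm hne) (by omega)
      refine (hRact n).2 ?_
      rw [← hmn]
      refine Set.Subset.trans ?_ (hinf.monotone (show m + 1 ≤ n from hlt))
      rw [hRJ m]
      exact Set.subset_union_right
    have hinj : Function.Injective fun k => idx (R (i + 1 + k)) := by
      intro k l hkl
      have := hRinj (hidx (hRd _) (hRd _) hkl)
      omega
    exact Set.infinite_range_of_injective hinj
      ((Set.finite_Iic (idx (result σ h))).subset (by rintro _ ⟨k, rfl⟩; exact hle k))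
  · push Not at hall
    have hex : ∃ n, ¬ (act (J n)).Nonempty := by
      obtain ⟨n, hn⟩ := hall
      exact ⟨n, by simp [hn]⟩
    let n := Nat.find hex
    refine ⟨_, Or.inl ⟨n, fun i => J i, ⟨rfl, fun i => ?_, ?_⟩, rfl⟩⟩
    · have : (act (J i)).Nonempty := not_not.mp (Nat.find_min hex i.2)
      exact hchase i this
    · intro σ h hact
      exact Nat.find_spec hex ⟨result σ h, ⟨σ, h, hact.1, rfl⟩, hact.2⟩

theorem existsUnique_isChaseResult {D : Set (Fact S)} (hD : D.Finite) {Γ : Set (TGD S)}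
    (hΓ : Γ.Finite) (hlin : ∀ σ ∈ Γ, σ.IsLinear) : ∃! J, IsChaseResult D Γ J := by
  obtain ⟨J, hJ⟩ := exists_isChaseResult hD hΓ hlin
  exact ⟨J, hJ, fun K hK => (hK.eq_derivable hlin).trans (hJ.eq_derivable hlin).symm⟩

theorem chase_eq_derivable {D : Set (Fact S)} (hD : D.Finite) {Γ : Set (TGD S)}
    (hΓ : Γ.Finite) (hlin : ∀ σ ∈ Γ, σ.IsLinear) : chase D Γ = derivable D Γ :=
  (Classical.epsilon_spec (exists_isChaseResult hD hΓ hlin)).eq_derivable hlin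

theorem ctExists_of_ctForall {D : Set (Fact S)} (hD : D.Finite) {Γ : Set (TGD S)}
    (hΓ : Γ.Finite) (hlin : ∀ σ ∈ Γ, σ.IsLinear) (h : Γ ∈ CTForall D) : Γ ∈ CTExists D := by
  obtain ⟨J, ⟨n, I, hI, -⟩ | ⟨I, hI, hf, -⟩⟩ := exists_isChaseResult hD hΓ hlin
  · exact ⟨n, I, hI⟩
  · exact absurd ⟨I, hI, hf⟩ h

theorem derivable_finite_of_ctExists {D : Set (Fact S)} (hD : D.Finite) {Γ : Set (TGD S)}
    (hlin : ∀ σ ∈ Γ, σ.IsLinear) (h : Γ ∈ CTExists D) : (derivable D Γ).Finite := by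
  obtain ⟨n, I, hI⟩ := h
  rw [← hI.eq_derivable hlin]
  exact hI.finite hD _

theorem ctForall_of_derivable_finite {D : Set (Fact S)} {Γ : Set (TGD S)}
    (hlin : ∀ σ ∈ Γ, σ.IsLinear) (h : (derivable D Γ).Finite) : Γ ∈ CTForall D := by
  rintro ⟨I, hI, -⟩
  exact Set.infinite_range_of_injective hI.strictMono.injective
    (h.finite_subsets.subset (by rintro _ ⟨i, rfl⟩; exact hI.subset_derivable hlin i))

end LinearChase

/-! ### Depth of terms. -/

section Depth

variable {S : Signature.{u}}

noncomputable instance : DecidableEq (GTerm S) := Classical.decEq _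

/-- The depth of a term: constants have depth `0`, and a null is one deeper than the deepest term
that its trigger assigns to a frontier variable. -/
noncomputable def GTerm.depth : GTerm S → ℕ
  | .const _ => 0
  | .null _ _ h => 1 + ⨆ y, (h y).depth

theorem TGD.bodyVars_finite (σ : TGD S) : σ.bodyVars.Finite := by
  have : σ.bodyVars = ⋃ a ∈ σ.body, a.vars := by
    ext x
    simp [TGD.bodyVars]
  rw [this]
  exact σ.body.finite_toSet.biUnion fun a _ => Set.finite_range _

instance (σ : TGD S) : Finite {x : Var // x ∈ σ.frontier} :=
  (σ.bodyVars_finite.subset Set.inter_subset_left).to_subtype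

theorem GTerm.depth_lt_null {σ : TGD S} (z : Var) (h : {x : Var // x ∈ σ.frontier} → GTerm S)
    (y : {x : Var // x ∈ σ.frontier}) : (h y).depth < (GTerm.null σ z h).depth := by
  have := le_ciSup (Set.finite_range fun y => (h y).depth).bddAbove y
  simp only [GTerm.depth]
  omega

/-- An empty frontier has supremum `0` in `ℕ`, so such a null has depth `1`; otherwise the finite
supremum is attained. -/
theorem GTerm.depth_null_eq {σ : TGD S} (z : Var) (h : {x : Var // x ∈ σ.frontier} → GTerm S) :
    (IsEmpty {x : Var // x ∈ σ.frontier} ∧ (GTerm.null σ z h).depth = 1) ∨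
      ∃ y, (GTerm.null σ z h).depth = (h y).depth + 1 ∧ ∀ y', (h y').depth ≤ (h y).depth := by
  rcases isEmpty_or_nonempty {x : Var // x ∈ σ.frontier} with he | hne
  · exact Or.inl ⟨he, by simp [GTerm.depth]⟩
  · obtain ⟨y, hy⟩ := exists_eq_ciSup_of_finite (f := fun y => (h y).depth)
    refine Or.inr ⟨y, ?_, fun y' => ?_⟩
    · simp only [GTerm.depth, ← hy]
      omega
    · rw [hy]
      exact le_ciSup (Set.finite_range fun y => (h y).depth).bddAbove y'

theorem extend_of_mem {σ : TGD S} {h : Var → GTerm S} {x : Var} (hx : x ∈ σ.frontier) :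
    extend σ h x = h x := if_pos hx

theorem extend_of_notMem {σ : TGD S} {h : Var → GTerm S} {x : Var} (hx : x ∉ σ.frontier) :
    extend σ h x = .null σ x fun y => h y.1 := if_neg hx

end Depth

/-! ### Equality patterns of atoms and positions of their simplifications. -/

section Shapes

variable {S : Signature.{u}}

theorem ident_congr {n : ℕ} {T U : Type*} [DecidableEq T] [DecidableEq U] {t : Fin n → T}
    {s : Fin n → U} (h : ∀ i j, t i = t j ↔ s i = s j) : ident t = ident s := by
  have hf : firsts t = firsts s := by
    ext i
    simp [firsts, h]
  funext i
  simp only [ident, hf, h]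

/-- The predicate of the simplification of an atom. -/
def Atom.shape {T : Type*} [DecidableEq T] (a : Atom S T) : SimplePred S :=
  ⟨a.pred, ident a.args⟩

/-- The simplification of `a` has the term `t` at the position `π`. -/
def Atom.Holds {T : Type*} [DecidableEq T] (a : Atom S T) (π : Position S.simple) (t : T) : Prop :=
  ∃ (l : Fin (S.arity a.pred) → ℕ) (k : Fin (firsts l).card), l = ident a.args ∧
    π = ⟨(⟨a.pred, l⟩ : SimplePred S), k⟩ ∧ a.args ((firsts l).orderEmbOfFin rfl k) = t

theorem Atom.Holds.shape_eq {T : Type*} [DecidableEq T] {a : Atom S T} {π : Position S.simple}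
    {t : T} (h : a.Holds π t) : π.1 = a.shape := by
  obtain ⟨l, k, rfl, rfl, -⟩ := h
  rfl

theorem Atom.Holds.unique {T : Type*} [DecidableEq T] {a : Atom S T} {π : Position S.simple}
    {t t' : T} (h : a.Holds π t) (h' : a.Holds π t') : t = t' := by
  obtain ⟨l, k, rfl, rfl, rfl⟩ := h
  obtain ⟨l, k', rfl, he, rfl⟩ := h'
  rw [eq_of_heq (Sigma.mk.inj he).2]

theorem Atom.Holds.mem {T : Type*} [DecidableEq T] {a : Atom S T} {π : Position S.simple}
    {t : T} (h : a.Holds π t) : ∃ i, a.args i = t := by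
  obtain ⟨l, k, -, -, h⟩ := h
  exact ⟨_, h⟩

theorem Atom.exists_holds {T : Type*} [DecidableEq T] (a : Atom S T) {π : Position S.simple}
    (h : π.1 = a.shape) : ∃ t, a.Holds π t := by
  obtain ⟨R, k⟩ := π
  subst h
  exact ⟨_, _, k, rfl, rfl, rfl⟩

theorem Atom.exists_position {T : Type*} [DecidableEq T] (a : Atom S T)
    (i : Fin (S.arity a.pred)) : ∃ π, a.Holds π (a.args i) := by
  obtain ⟨j, hj, hji, -⟩ := exists_first a.args i
  rw [← firsts_ident] at hj
  have : j ∈ Set.range ((firsts (ident a.args)).orderEmbOfFin rfl) := by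
    rw [Finset.range_orderEmbOfFin]
    exact hj
  obtain ⟨k, hk⟩ := this
  exact ⟨_, _, k, rfl, rfl, by rw [hk, hji]⟩

theorem orderEmbOfFin_cast {n : ℕ} {s t : Finset (Fin n)} (h : s = t) (k : Fin s.card) :
    t.orderEmbOfFin rfl (Fin.cast (congrArg Finset.card h) k) = s.orderEmbOfFin rfl k := by
  subst h
  rfl

/-- Connects the positions of the dependency graph with `Atom.Holds`, which indexes first
occurrences through the tuple of identifiers alone, so that atoms of equal shape share positions. -/
theorem Atom.mem_pos_simple_iff (a : Atom S Var) (π : Position S.simple) (x : Var) :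
    π ∈ a.simple.pos x ↔ a.Holds π x := by
  have key (k) : a.simple.args k = a.args ((firsts (ident a.args)).orderEmbOfFin rfl k) :=
    congrArg a.args (orderEmbOfFin_cast (firsts_ident a.args) k)
  constructor
  · rintro ⟨k, rfl, rfl⟩
    exact ⟨_, k, rfl, rfl, (key k).symm⟩
  · rintro ⟨l, k, rfl, rfl, rfl⟩
    exact ⟨k, rfl, key k⟩

theorem Atom.mem_vars_simple_iff (a : Atom S Var) (x : Var) :
    x ∈ a.simple.vars ↔ x ∈ a.vars := by
  constructor
  · rintro ⟨k, rfl⟩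
    exact ((a.mem_pos_simple_iff _ _).mp ⟨k, rfl, rfl⟩).mem
  · rintro ⟨i, rfl⟩
    obtain ⟨π, hπ⟩ := a.exists_position i
    obtain ⟨k, -, hk⟩ := (a.mem_pos_simple_iff _ _).mpr hπ
    exact ⟨k, hk⟩

theorem Atom.shape_map_congr {V T U : Type*} [DecidableEq T] [DecidableEq U] (a : Atom S V)
    {f : V → T} {g : V → U}
    (h : ∀ i j, f (a.args i) = f (a.args j) ↔ g (a.args i) = g (a.args j)) :
    (a.map f).shape = (a.map g).shape := by
  unfold Atom.shape Atom.map
  congr 1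
  exact ident_congr h

/-- Maps that identify the same arguments of `a` give the same identifiers, so a position picks the
same argument slot in both images. -/
theorem Atom.Holds.transfer {V T U : Type*} [DecidableEq T] [DecidableEq U] {a : Atom S V}
    {f : V → T} {g : V → U}
    (h : ∀ i j, f (a.args i) = f (a.args j) ↔ g (a.args i) = g (a.args j))
    {π : Position S.simple} {t : T} (ht : (a.map f).Holds π t) :
    ∃ i, t = f (a.args i) ∧ (a.map g).Holds π (g (a.args i)) := by
  obtain ⟨l, k, hl, hπ, hk⟩ := ht
  exact ⟨_, hk.symm, l, k, hl.trans (ident_congr h), hπ, rfl⟩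

end Shapes

/-! ### Specializations as equality patterns of homomorphisms. -/

section Specialization

variable {S : Signature.{u}}

theorem IsSpecialization.mem_range {n : ℕ} {x : Fin n → Var} {f : Var → Var}
    (hf : IsSpecialization x f) (i : Fin n) : f (x i) ∈ Set.range x := by
  induction i using WellFoundedLT.induction with
  | _ i ih =>
    rcases hf.1 i with h | ⟨j, hj, h⟩
    · exact ⟨i, h.symm⟩
    · rw [h]
      exact ih j hj

/-- The specialization `f` of the variables of `a` identifies the same variables of `a` as the
assignment `h`. -/
def Agrees {T : Type*} (a : Atom S Var) (f : Var → Var) (h : Var → T) : Prop :=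
  IsSpecialization a.args f ∧ ∀ i j, f (a.args i) = f (a.args j) ↔ h (a.args i) = h (a.args j)

theorem exists_agrees {T : Type*} [DecidableEq T] (a : Atom S Var) (h : Var → T) : ∃ f, Agrees a f h := by
  choose k hk hkh hki using exists_first fun i => h (a.args i)
  have hkk {i j} (hij : h (a.args i) = h (a.args j)) : k i = k j :=
    first_unique _ (hk i) (hk j) (by rw [hkh, hkh, hij])
  -- Each variable goes to the first argument of `a` that has the same value under `h`.
  let f : Var → Var := fun y => if hy : ∃ i, a.args i = y then a.args (k hy.choose) else y
  have hf (i) : f (a.args i) = a.args (k i) := by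
    have hy : ∃ j, a.args j = a.args i := ⟨i, rfl⟩
    simp only [f, dif_pos hy]
    rw [hkk (congrArg h hy.choose_spec)]
  refine ⟨f, ⟨fun i => ?_, fun y hy => dif_neg hy⟩, fun i j => ?_⟩
  · rcases (hki i).lt_or_eq with hlt | he
    · exact Or.inr ⟨k i, hlt, by rw [hf, hf, hkk (hkh i)]⟩
    · exact Or.inl (by rw [hf, he])
  · rw [hf, hf]
    constructor
    · intro he
      rw [← hkh i, ← hkh j, he]
    · intro he
      rw [hkk he]

/-- Slots of `a` that hold the same variable are identified by `f`, hence hold equal terms in `β`;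
so reading `h` off `β` is well defined. -/
theorem exists_map_eq {a : Atom S Var} {f : Var → Var} (hf : IsSpecialization a.args f)
    {T : Type*} [DecidableEq T] {β : Atom S T} (hβ : β.shape = (a.map f).shape) :
    ∃ h : Var → T, a.map h = β ∧ Agrees a f h := by
  obtain ⟨R, t⟩ := β
  simp only [Atom.shape, Atom.map, SimplePred.mk.injEq] at hβ
  obtain ⟨rfl, hβ⟩ := hβ
  rw [heq_eq_eq] at hβ
  have hid (i j) : f (a.args i) = f (a.args j) ↔ t i = t j := by
    rw [← ident_eq_iff t, hβ, ident_eq_iff]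
  have : Nonempty T := ⟨t ⟨0, S.arity_pos _⟩⟩
  let h : Var → T := fun y =>
    if hy : ∃ i, a.args i = y then t hy.choose else Classical.arbitrary T
  have hh (i) : h (a.args i) = t i := by
    have hy : ∃ j, a.args j = a.args i := ⟨i, rfl⟩
    simp only [h, dif_pos hy]
    exact (hid _ _).mp (by rw [hy.choose_spec])
  refine ⟨h, ?_, hf, fun i j => by rw [hh, hh, hid]⟩
  simp only [Atom.map, hh]

theorem TGD.mem_bodyVars_iff {σ : TGD S} {a : Atom S Var} (ha : σ.body = {a}) {x : Var} :
    x ∈ σ.bodyVars ↔ ∃ i, a.args i = x := by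
  simp [TGD.bodyVars, ha, Atom.vars]

theorem Agrees.eq_of_notMem {σ : TGD S} {a : Atom S Var} (ha : σ.body = {a})
    {T : Type*} {f : Var → Var} {h : Var → T} (hf : Agrees a f h) {x : Var}
    (hx : x ∉ σ.bodyVars) : f x = x := by
  rw [TGD.mem_bodyVars_iff ha] at hx
  exact hf.1.2 x hx

theorem Agrees.apply_mem_iff {σ : TGD S} {a : Atom S Var} (ha : σ.body = {a})
    {T : Type*} {f : Var → Var} {h : Var → T} (hf : Agrees a f h) {x : Var} :
    f x ∈ σ.bodyVars ↔ x ∈ σ.bodyVars := by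
  by_cases hx : x ∈ σ.bodyVars
  · simp only [hx, iff_true]
    obtain ⟨i, rfl⟩ := (TGD.mem_bodyVars_iff ha).mp hx
    exact (TGD.mem_bodyVars_iff ha).mpr (hf.1.mem_range i)
  · rw [hf.eq_of_notMem ha hx]

theorem Agrees.apply_eq_iff {σ : TGD S} {a : Atom S Var} (ha : σ.body = {a})
    {T : Type*} {f : Var → Var} {h : Var → T} (hf : Agrees a f h) {x y : Var}
    (hx : x ∈ σ.bodyVars) (hy : y ∈ σ.bodyVars) : f x = f y ↔ h x = h y := by
  obtain ⟨i, rfl⟩ := (TGD.mem_bodyVars_iff ha).mp hx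
  obtain ⟨j, rfl⟩ := (TGD.mem_bodyVars_iff ha).mp hy
  exact hf.2 i j

/-- Agreement on the body carries over to the head. On the variable side `f` maps body variables to
body variables and fixes the existential ones; on the term side a null is deeper than every frontier
term, and nulls of one trigger differ when their variables do. -/
theorem Agrees.apply_eq_iff_extend {σ : TGD S} {a : Atom S Var} (ha : σ.body = {a})
    {f : Var → Var} {h : Var → GTerm S} (hf : Agrees a f h) {x y : Var}
    (hx : x ∈ σ.headVars) (hy : y ∈ σ.headVars) :
    f x = f y ↔ extend σ h x = extend σ h y := by
  by_cases hxb : x ∈ σ.bodyVars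
  · by_cases hyb : y ∈ σ.bodyVars
    · rw [extend_of_mem ⟨hxb, hx⟩, extend_of_mem ⟨hyb, hy⟩, hf.apply_eq_iff ha hxb hyb]
    · rw [extend_of_mem ⟨hxb, hx⟩, extend_of_notMem fun hc => hyb hc.1]
      refine iff_of_false (fun he => hyb ?_) fun he => ?_
      · rwa [← hf.apply_mem_iff ha, ← he, hf.apply_mem_iff ha]
      · have := GTerm.depth_lt_null y (fun y : {x : Var // x ∈ σ.frontier} => h y.1)
          ⟨x, hxb, hx⟩
        rw [← he] at this
        exact lt_irrefl _ this
  · by_cases hyb : y ∈ σ.bodyVars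
    · rw [extend_of_mem ⟨hyb, hy⟩, extend_of_notMem fun hc => hxb hc.1]
      refine iff_of_false (fun he => hxb ?_) fun he => ?_
      · rwa [← hf.apply_mem_iff ha, he, hf.apply_mem_iff ha]
      · have := GTerm.depth_lt_null x (fun y : {x : Var // x ∈ σ.frontier} => h y.1)
          ⟨y, hyb, hy⟩
        rw [he] at this
        exact lt_irrefl _ this
    · rw [extend_of_notMem fun hc => hxb hc.1, extend_of_notMem fun hc => hyb hc.1,
        hf.eq_of_notMem ha hxb, hf.eq_of_notMem ha hyb]
      simp

theorem Agrees.head {σ : TGD S} {a : Atom S Var} (ha : σ.body = {a})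
    {f : Var → Var} {h : Var → GTerm S} (hf : Agrees a f h) {b : Atom S Var} (hb : b ∈ σ.head)
    (i j) : f (b.args i) = f (b.args j) ↔ extend σ h (b.args i) = extend σ h (b.args j) :=
  hf.apply_eq_iff_extend ha ⟨b, hb, i, rfl⟩ ⟨b, hb, j, rfl⟩

theorem mem_simpleTGDs_iff {Γ : Set (TGD S)} {τ : TGD S.simple} :
    τ ∈ simpleTGDs Γ ↔
      ∃ σ ∈ Γ, ∃ a ∈ σ.body, ∃ f, IsSpecialization a.args f ∧ τ = σ.simplify f := by
  simp [simpleTGDs, TGD.simple]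

theorem TGD.mem_simplify_body_iff {σ : TGD S} {f : Var → Var} {c : Atom S.simple Var} :
    c ∈ (σ.simplify f).body ↔ ∃ a ∈ σ.body, (a.map f).simple = c := by
  simp [TGD.simplify]

theorem TGD.mem_simplify_head_iff {σ : TGD S} {f : Var → Var} {c : Atom S.simple Var} :
    c ∈ (σ.simplify f).head ↔ ∃ b ∈ σ.head, (b.map f).simple = c := by
  simp [TGD.simplify]

theorem TGD.mem_simplify_bodyVars_iff {σ : TGD S} {f : Var → Var} {x : Var} :
    x ∈ (σ.simplify f).bodyVars ↔ ∃ y ∈ σ.bodyVars, f y = x := by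
  constructor
  · rintro ⟨c, hc, hx⟩
    obtain ⟨a, ha, rfl⟩ := TGD.mem_simplify_body_iff.mp hc
    rw [Atom.mem_vars_simple_iff] at hx
    obtain ⟨i, rfl⟩ := hx
    exact ⟨_, ⟨a, ha, i, rfl⟩, rfl⟩
  · rintro ⟨y, ⟨a, ha, i, rfl⟩, rfl⟩
    exact ⟨_, TGD.mem_simplify_body_iff.mpr ⟨a, ha, rfl⟩,
      (Atom.mem_vars_simple_iff _ _).mpr ⟨i, rfl⟩⟩

theorem TGD.mem_simplify_headVars_iff {σ : TGD S} {f : Var → Var} {x : Var} :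
    x ∈ (σ.simplify f).headVars ↔ ∃ y ∈ σ.headVars, f y = x := by
  constructor
  · rintro ⟨c, hc, hx⟩
    obtain ⟨a, ha, rfl⟩ := TGD.mem_simplify_head_iff.mp hc
    rw [Atom.mem_vars_simple_iff] at hx
    obtain ⟨i, rfl⟩ := hx
    exact ⟨_, ⟨a, ha, i, rfl⟩, rfl⟩
  · rintro ⟨y, ⟨a, ha, i, rfl⟩, rfl⟩
    exact ⟨_, TGD.mem_simplify_head_iff.mpr ⟨a, ha, rfl⟩,
      (Atom.mem_vars_simple_iff _ _).mpr ⟨i, rfl⟩⟩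

end Specialization

/-! ### A finite chase forces weak-acyclicity of the simplification. -/

section Unbounded

variable {S : Signature.{u}}

/-- A simplified TGD whose body predicate is the shape of `β` always comes from a genuine trigger on
`β`; paths in the simplified dependency graph can therefore be followed by derivable atoms. -/
theorem mem_simpleTGDs_matches {Γ : Set (TGD S)} (hlin : ∀ σ ∈ Γ, σ.IsLinear)
    {τ : TGD S.simple} (hτ : τ ∈ simpleTGDs Γ) {β : Atom S (GTerm S)} {c : Atom S.simple Var}
    (hc : c ∈ τ.body) (hβ : c.pred = β.shape) :
    ∃ σ ∈ Γ, ∃ a f h, σ.body = {a} ∧ Agrees a f h ∧ a.map h = β ∧ τ = σ.simplify f := by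
  obtain ⟨σ, hσ, a, ha, f, hf, rfl⟩ := mem_simpleTGDs_iff.mp hτ
  obtain ⟨a', hb⟩ := (hlin σ hσ).exists_body
  obtain rfl : a = a' := by simpa [hb] using ha
  obtain ⟨a', ha', rfl⟩ := TGD.mem_simplify_body_iff.mp hc
  obtain rfl : a' = a := by simpa [hb] using ha'
  obtain ⟨h, hβ', hfh⟩ := exists_map_eq hf (β := β) hβ.symm
  exact ⟨σ, hσ, a', f, h, hb, hfh, hβ', rfl⟩

theorem derivable_tail {D : Set (Fact S)} {Γ : Set (TGD S)} {β : Atom S (GTerm S)}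
    (hβ : β ∈ derivable D Γ) {σ : TGD S} (hσ : σ ∈ Γ) {a : Atom S Var} (ha : σ.body = {a})
    {h : Var → GTerm S} (hh : a.map h = β) {b : Atom S Var} (hb : b ∈ σ.head) :
    b.map (extend σ h) ∈ derivable D Γ := by
  obtain ⟨α, hα, hαβ⟩ := hβ
  exact ⟨α, hα, hαβ.tail ⟨σ, hσ, h, by simpa [ha] using hh, b, hb, rfl⟩⟩

/-- Some derivable atom has at the position `π` a term of depth at least `d`. -/
def Realized (D : Set (Fact S)) (Γ : Set (TGD S)) (π : Position S.simple) (d : ℕ) : Prop :=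
  ∃ β ∈ derivable D Γ, ∃ t, β.Holds π t ∧ d ≤ t.depth

/-- The variable of `a` at the given position need not occur in the head of `σ`, but some variable
that `f` identifies with it does, and `h` gives both the same value. -/
theorem frontier_match {σ : TGD S} {a : Atom S Var} (ha : σ.body = {a}) {f : Var → Var}
    {h : Var → GTerm S} (hf : Agrees a f h) {x : Var} (hx : x ∈ (σ.simplify f).frontier)
    {c : Atom S.simple Var} (hc : c ∈ (σ.simplify f).body) {π : Position S.simple}
    (hπ : π ∈ c.pos x) {t : GTerm S} (ht : (a.map h).Holds π t) :
    ∃ y ∈ σ.frontier, f y = x ∧ h y = t := by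
  obtain ⟨a', ha', rfl⟩ := TGD.mem_simplify_body_iff.mp hc
  obtain rfl : a' = a := by simpa [ha] using ha'
  rw [Atom.mem_pos_simple_iff] at hπ
  obtain ⟨i, rfl, hi⟩ := hπ.transfer hf.2
  obtain rfl := ht.unique hi
  obtain ⟨y, hy, hyi⟩ := TGD.mem_simplify_headVars_iff.mp hx.2
  have hib : a'.args i ∈ σ.bodyVars := (TGD.mem_bodyVars_iff ha).mpr ⟨i, rfl⟩
  have hyb : y ∈ σ.bodyVars := by
    rw [← hf.apply_mem_iff ha, hyi, hf.apply_mem_iff ha]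
    exact hib
  exact ⟨y, ⟨hyb, hy⟩, hyi, (hf.apply_eq_iff ha hyb hib).mp hyi⟩

theorem Atom.pos_pred {c : Atom S Var} {π : Position S} {x : Var} (h : π ∈ c.pos x) :
    c.pred = π.1 := by
  obtain ⟨i, rfl, -⟩ := h
  rfl

theorem Realized.normalEdge {D : Set (Fact S)} {Γ : Set (TGD S)} (hlin : ∀ σ ∈ Γ, σ.IsLinear)
    {π π' : Position S.simple} {d : ℕ} (h : Realized D Γ π d)
    (he : NormalEdge (simpleTGDs Γ) π π') : Realized D Γ π' d := by
  obtain ⟨β, hβ, t, ht, hd⟩ := h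
  obtain ⟨τ, hτ, x, hx, ⟨c, hc, hcπ⟩, c', hc', hcπ'⟩ := he
  obtain ⟨σ, hσ, a, f, h, ha, hf, rfl, rfl⟩ :=
    mem_simpleTGDs_matches hlin hτ hc ((Atom.pos_pred hcπ).trans ht.shape_eq)
  obtain ⟨y, hy, hyx, rfl⟩ := frontier_match ha hf hx hc hcπ ht
  obtain ⟨b, hb, rfl⟩ := TGD.mem_simplify_head_iff.mp hc'
  rw [Atom.mem_pos_simple_iff] at hcπ'
  obtain ⟨j, hj, hjπ⟩ := hcπ'.transfer (hf.head ha hb)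
  refine ⟨_, derivable_tail hβ hσ ha rfl hb, _, hjπ, ?_⟩
  rw [← (hf.apply_eq_iff_extend ha hy.2 ⟨b, hb, j, rfl⟩).mp (hyx.trans hj), extend_of_mem hy]
  exact hd

theorem Realized.specialEdge {D : Set (Fact S)} {Γ : Set (TGD S)} (hlin : ∀ σ ∈ Γ, σ.IsLinear)
    {π π' : Position S.simple} {d : ℕ} (h : Realized D Γ π d)
    (he : SpecialEdge (simpleTGDs Γ) π π') : Realized D Γ π' (d + 1) := by
  obtain ⟨β, hβ, t, ht, hd⟩ := h
  obtain ⟨τ, hτ, x, hx, ⟨c, hc, hcπ⟩, z, hz, c', hc', hcπ'⟩ := he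
  obtain ⟨σ, hσ, a, f, h, ha, hf, rfl, rfl⟩ :=
    mem_simpleTGDs_matches hlin hτ hc ((Atom.pos_pred hcπ).trans ht.shape_eq)
  obtain ⟨y, hy, hyx, rfl⟩ := frontier_match ha hf hx hc hcπ ht
  obtain ⟨b, hb, rfl⟩ := TGD.mem_simplify_head_iff.mp hc'
  rw [Atom.mem_pos_simple_iff] at hcπ'
  obtain ⟨j, rfl, hjπ⟩ := hcπ'.transfer (hf.head ha hb)
  refine ⟨_, derivable_tail hβ hσ ha rfl hb, _, hjπ, ?_⟩
  have hjb : b.args j ∉ σ.frontier := fun hj =>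
    hz.2 (TGD.mem_simplify_bodyVars_iff.mpr ⟨_, hj.1, rfl⟩)
  rw [extend_of_notMem hjb]
  exact lt_of_le_of_lt hd (GTerm.depth_lt_null _ (fun y => h y.1) ⟨y, hy⟩)

theorem exists_shape_of_predArrow {D : Set (Fact S)} {Γ : Set (TGD S)}
    (hlin : ∀ σ ∈ Γ, σ.IsLinear) {R P : SimplePred S}
    (hR : ∃ β ∈ derivable D Γ, β.shape = R) (h : PredArrow (simpleTGDs Γ) R P) :
    ∃ β ∈ derivable D Γ, β.shape = P := by
  obtain ⟨-, -, rfl | ⟨τ, hτ, ⟨c, hc, hcR⟩, c', hc', rfl⟩⟩ := h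
  · exact hR
  · obtain ⟨β, hβ, rfl⟩ := hR
    obtain ⟨σ, hσ, a, f, h, ha, hf, rfl, rfl⟩ := mem_simpleTGDs_matches hlin hτ hc hcR
    obtain ⟨b, hb, rfl⟩ := TGD.mem_simplify_head_iff.mp hc'
    exact ⟨_, derivable_tail hβ hσ ha rfl hb, (b.shape_map_congr (hf.head ha hb)).symm⟩

theorem Fact.shape_map_const (α : Fact S) :
    (α.map (GTerm.const (S := S))).shape = α.shape :=
  α.shape_map_congr (f := GTerm.const) (g := id) (by simp)

theorem Reachable.exists_shape {D : Set (Fact S)} {Γ : Set (TGD S)}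
    (hlin : ∀ σ ∈ Γ, σ.IsLinear) {α : Fact S.simple} (hα : α ∈ simpleDB D) {P : SimplePred S}
    (h : Reachable (simpleTGDs Γ) α.pred P) : ∃ β ∈ derivable D Γ, β.shape = P := by
  obtain ⟨α, hα, rfl⟩ := hα
  have h0 : ∃ β ∈ derivable D Γ, β.shape = α.simple.pred :=
    ⟨_, ⟨_, ⟨α, hα, rfl⟩, .refl⟩, Fact.shape_map_const α⟩
  induction h with
  | single h => exact exists_shape_of_predArrow hlin h0 h
  | tail _ h ih => exact exists_shape_of_predArrow hlin ih h

theorem not_finite_of_depth_unbounded {D : Set (Fact S)} {Γ : Set (TGD S)}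
    {π : Position S.simple} (h : ∀ d, Realized D Γ π d) : ¬ (derivable D Γ).Finite := by
  intro hfin
  have : (⋃ β ∈ derivable D Γ, Set.range β.args).Finite :=
    hfin.biUnion fun β _ => Set.finite_range _
  obtain ⟨m, hm⟩ := (this.image GTerm.depth).bddAbove
  obtain ⟨β, hβ, t, ht, hd⟩ := h (m + 1)
  have := hm ⟨t, Set.mem_biUnion hβ ht.mem, rfl⟩
  omega

/-- Reachability realizes a position of a forbidden cycle by a derivable atom. Following the cycle
keeps the depth at normal edges and raises it at special ones, so repeated turns produce terms of
unbounded depth. -/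
theorem weaklyAcyclic_of_derivable_finite {D : Set (Fact S)} {Γ : Set (TGD S)}
    (hlin : ∀ σ ∈ Γ, σ.IsLinear) (hfin : (derivable D Γ).Finite) :
    WeaklyAcyclic (simpleDB D) (simpleTGDs Γ) := by
  rintro ⟨n, c, hc, hedge, ⟨s, hs, hspec⟩, i, hi, α, hα, hreach⟩
  have step : ∀ k < n, ∀ d, Realized D Γ (c k) d → Realized D Γ (c (k + 1)) d := by
    intro k hk d h
    rcases hedge k hk with he | he
    · exact h.normalEdge hlin he
    · obtain ⟨β, hβ, t, ht, hd⟩ := h.specialEdge hlin he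
      exact ⟨β, hβ, t, ht, by omega⟩
  have steps : ∀ k l, k ≤ l → l ≤ n → ∀ d, Realized D Γ (c k) d → Realized D Γ (c l) d := by
    intro k l hkl
    induction l, hkl using Nat.le_induction with
    | base => exact fun _ _ h => h
    | succ l hkl ih => exact fun hl d h => step l (by omega) d (ih (by omega) d h)
  have h0 : Realized D Γ (c 0) 0 := by
    obtain ⟨β, hβ, hshape⟩ := hreach.exists_shape hlin hα
    obtain ⟨t, ht⟩ := β.exists_holds hshape.symm
    rw [← hc]
    exact steps i n hi le_rfl 0 ⟨β, hβ, t, ht, by omega⟩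
  refine not_finite_of_depth_unbounded (π := c 0) (fun d => ?_) hfin
  induction d with
  | zero => exact h0
  | succ d ih =>
    rw [← hc]
    exact steps (s + 1) n hs le_rfl _
      ((steps 0 s (by omega) (by omega) d ih).specialEdge hlin hspec)

end Unbounded

/-! ### Weak-acyclicity bounds the depth of terms. -/

section DepthBound

variable {S : Signature.{u}}

/-- An edge of the dependency graph. -/
def Edge (Γ : Set (TGD S)) (π π' : Position S) : Prop := NormalEdge Γ π π' ∨ SpecialEdge Γ π π'

/-- Some path from `π` to `π'` in the dependency graph has a special edge. -/
def SpecialPath (Γ : Set (TGD S)) (π π' : Position S) : Prop :=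
  ∃ u v, Relation.ReflTransGen (Edge Γ) π u ∧ SpecialEdge Γ u v ∧
    Relation.ReflTransGen (Edge Γ) v π'

theorem exists_path_of_reflTransGen {α : Type*} {r : α → α → Prop} {x y : α}
    (h : Relation.ReflTransGen r x y) :
    ∃ (n : ℕ) (c : ℕ → α), c 0 = x ∧ c n = y ∧ ∀ i < n, r (c i) (c (i + 1)) := by
  induction h with
  | refl => exact ⟨0, fun _ => x, rfl, rfl, by simp⟩
  | @tail y z _ hyz ih =>
    obtain ⟨n, c, h0, hn, hc⟩ := ih
    refine ⟨n + 1, fun i => if i ≤ n then c i else z, by simp [h0], by simp, fun i hi => ?_⟩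
    rcases (Nat.lt_succ_iff.mp hi).lt_or_eq with hlt | rfl
    · simpa [hlt.le, Nat.succ_le_of_lt hlt] using hc i hlt
    · simpa [hn] using hyz

theorem SpecialPath.not_weaklyAcyclic {D : Set (Fact S)} {Γ : Set (TGD S)} {π : Position S}
    (h : SpecialPath Γ π π) {α : Fact S} (hα : α ∈ D) (hr : Reachable Γ α.pred π.1) :
    ¬ WeaklyAcyclic D Γ := by
  obtain ⟨u, v, h1, hs, h2⟩ := h
  obtain ⟨n, c, hc0, hcn, hc⟩ := exists_path_of_reflTransGen h1
  obtain ⟨m, e, he0, hem, he⟩ := exists_path_of_reflTransGen h2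
  -- The second path starts at index `n + 1`, so the special edge from `u` to `v` is the step from
  -- `n` to `n + 1`.
  let p : ℕ → Position S := fun i => if i ≤ n then c i else e (i - (n + 1))
  have hp1 (i) (hi : i ≤ n) : p i = c i := if_pos hi
  have hp2 (i) : p (n + 1 + i) = e i := by
    simp only [p]
    rw [if_neg (by omega)]
    congr 1
    omega
  have hspec : SpecialEdge Γ (p n) (p (n + 1)) := by
    have := hp2 0
    rw [add_zero] at this
    rw [hp1 n le_rfl, this, hcn, he0]
    exact hs
  have hp0 : p 0 = π := by rw [hp1 0 (by omega), hc0]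
  refine not_not.mpr ⟨n + 1 + m, p, by rw [hp2, hem, hp0], fun i hi => ?_,
    ⟨n, by omega, hspec⟩, 0, by omega, α, hα, by rwa [hp0]⟩
  rcases lt_trichotomy i n with hlt | rfl | hlt
  · rw [hp1 i hlt.le, hp1 (i + 1) hlt]
    exact hc i hlt
  · exact Or.inr hspec
  · obtain ⟨j, rfl⟩ := Nat.exists_eq_add_of_le hlt
    rw [Nat.succ_eq_add_one, hp2, add_assoc _ j 1, hp2]
    exact he j (by omega)

theorem SpecialPath.edge {Γ : Set (TGD S)} {π π' π'' : Position S} (h : SpecialPath Γ π π')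
    (he : Edge Γ π' π'') : SpecialPath Γ π π'' := by
  obtain ⟨u, v, h1, hs, h2⟩ := h
  exact ⟨u, v, h1, hs, h2.tail he⟩

theorem SpecialEdge.specialPath {Γ : Set (TGD S)} {π π' : Position S} (h : SpecialEdge Γ π π') :
    SpecialPath Γ π π' := ⟨π, π', .refl, h, .refl⟩

/-- The converse of following edges by atoms: specializing by the equality pattern of the trigger
traces each new argument back. Frontier terms arrive along normal edges; a null arrives along a
special edge from its deepest frontier term, unless the frontier is empty, when it has no such edge
but depth `1`. -/
theorem Succ.exists_simple {Γ : Set (TGD S)} (hlin : ∀ σ ∈ Γ, σ.IsLinear)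
    {β γ : Atom S (GTerm S)} (h : Succ Γ β γ) :
    PredArrow (simpleTGDs Γ) β.shape γ.shape ∧ ∀ π' t', γ.Holds π' t' →
      (∃ π, β.Holds π t' ∧ NormalEdge (simpleTGDs Γ) π π') ∨ t'.depth ≤ 1 ∨
      ∃ π t, β.Holds π t ∧ t'.depth = t.depth + 1 ∧ SpecialEdge (simpleTGDs Γ) π π' := by
  obtain ⟨σ, hσ, h, hbody, b, hb, rfl⟩ := h
  obtain ⟨a, ha⟩ := (hlin σ hσ).exists_body
  obtain rfl := hbody a (by simp [ha])
  obtain ⟨f, hf⟩ := exists_agrees a h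
  have hτ : σ.simplify f ∈ simpleTGDs Γ :=
    mem_simpleTGDs_iff.mpr ⟨σ, hσ, a, by simp [ha], f, hf.1, rfl⟩
  have hca : (a.map f).simple ∈ (σ.simplify f).body :=
    TGD.mem_simplify_body_iff.mpr ⟨a, by simp [ha], rfl⟩
  have hcb : (b.map f).simple ∈ (σ.simplify f).head :=
    TGD.mem_simplify_head_iff.mpr ⟨b, hb, rfl⟩
  have hsa : (a.map f).simple.pred = (a.map h).shape := a.shape_map_congr hf.2
  have hsb : (b.map f).simple.pred = (b.map (extend σ h)).shape :=
    b.shape_map_congr (hf.head ha hb)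
  refine ⟨⟨⟨_, ⟨_, hτ, Or.inl hca⟩, hsa⟩, ⟨_, ⟨_, hτ, Or.inr hcb⟩, hsb⟩,
    Or.inr ⟨_, hτ, ⟨_, hca, hsa⟩, _, hcb, hsb⟩⟩, fun π' t' ht' => ?_⟩
  obtain ⟨j, rfl, hj⟩ := Atom.Holds.transfer (fun i j => (hf.head ha hb i j).symm) ht'
  have hjh : b.args j ∈ σ.headVars := ⟨b, hb, j, rfl⟩
  have source (y) (hy : y ∈ σ.frontier) : f y ∈ (σ.simplify f).frontier ∧
      ∃ π, (a.map h).Holds π (h y) ∧ π ∈ (a.map f).simple.pos (f y) := by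
    refine ⟨⟨TGD.mem_simplify_bodyVars_iff.mpr ⟨y, hy.1, rfl⟩,
      TGD.mem_simplify_headVars_iff.mpr ⟨y, hy.2, rfl⟩⟩, ?_⟩
    obtain ⟨i, rfl⟩ := (TGD.mem_bodyVars_iff ha).mp hy.1
    obtain ⟨π, hπ⟩ := (a.map h).exists_position i
    refine ⟨π, hπ, ?_⟩
    obtain ⟨i', he, hi'⟩ := Atom.Holds.transfer (fun i j => (hf.2 i j).symm) hπ
    rw [Atom.mem_pos_simple_iff, (hf.2 i i').mpr he]
    exact hi'
  by_cases hy : b.args j ∈ σ.frontier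
  · left
    obtain ⟨hfr, π, hπ, hpos⟩ := source _ hy
    rw [extend_of_mem hy]
    exact ⟨π, hπ, _, hτ, _, hfr, ⟨_, hca, hpos⟩, _, hcb, (Atom.mem_pos_simple_iff _ _ _).mpr hj⟩
  · right
    rw [extend_of_notMem hy]
    rcases GTerm.depth_null_eq (b.args j) (fun y : {x : Var // x ∈ σ.frontier} => h y.1) with
      ⟨-, h1⟩ | ⟨y, hy1, -⟩
    · exact Or.inl h1.le
    · right
      obtain ⟨hfr, π, hπ, hpos⟩ := source _ y.2
      refine ⟨π, _, hπ, hy1, _, hτ, _, hfr, ⟨_, hca, hpos⟩, f (b.args j),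
        ⟨TGD.mem_simplify_headVars_iff.mpr ⟨_, hjh, rfl⟩, fun hc => hy ⟨?_, hjh⟩⟩, _, hcb,
        (Atom.mem_pos_simple_iff _ _ _).mpr hj⟩
      obtain ⟨y', hy', he⟩ := TGD.mem_simplify_bodyVars_iff.mp hc
      rwa [← hf.apply_mem_iff ha, ← he, hf.apply_mem_iff ha]

/-- `Reachable` is reflexive only on predicates of the schema, so a database predicate needs the
alternative `α.pred = R` until an arrow shows that it belongs to the schema. -/
theorem PredArrow.reachable_of_or {D : Set (Fact S)} {Γ : Set (TGD S)} {R P : S.Pred}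
    (h : PredArrow Γ R P) (hR : ∃ α ∈ D, α.pred = R ∨ Reachable Γ α.pred R) :
    (∃ α ∈ D, Reachable Γ α.pred R) ∧ ∃ α ∈ D, Reachable Γ α.pred P := by
  obtain ⟨α, hα, rfl | hr⟩ := hR
  · exact ⟨⟨α, hα, .single ⟨h.1, h.1, Or.inl rfl⟩⟩, α, hα, .single h⟩
  · exact ⟨⟨α, hα, hr⟩, α, hα, hr.tail h⟩

/-- In a derivation from a database, the depth of the terms at a position is bounded by the number
of positions on some path to it. -/
theorem exists_finset_depth_le {D : Set (Fact S)} {Γ : Set (TGD S)}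
    (hlin : ∀ σ ∈ Γ, σ.IsLinear) (hwa : WeaklyAcyclic (simpleDB D) (simpleTGDs Γ))
    {α β : Atom S (GTerm S)} (hα : α ∈ toInstance D)
    (hβ : Relation.ReflTransGen (Succ Γ) α β) :
    (∃ γ ∈ simpleDB D, γ.pred = β.shape ∨ Reachable (simpleTGDs Γ) γ.pred β.shape) ∧
    ∀ π t, β.Holds π t → ∃ F : Finset (Position S.simple), (∀ q ∈ F, q.1 ∈ sch (simpleTGDs Γ) ∧
      SpecialPath (simpleTGDs Γ) q π) ∧ t.depth ≤ F.card + 1 := by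
  classical
  induction hβ with
  | refl =>
    obtain ⟨α, hα, rfl⟩ := hα
    refine ⟨⟨_, ⟨α, hα, rfl⟩, Or.inl (Fact.shape_map_const α).symm⟩, fun π t ht => ?_⟩
    obtain ⟨i, rfl⟩ := ht.mem
    exact ⟨∅, by simp, by simp [Atom.map, GTerm.depth]⟩
  | @tail β γ _ hs ih =>
    obtain ⟨hreach, ih⟩ := ih
    obtain ⟨harrow, hs⟩ := hs.exists_simple hlin
    obtain ⟨⟨ω, hω, hωβ⟩, ω', hω', hωγ⟩ := harrow.reachable_of_or hreach
    refine ⟨⟨ω', hω', Or.inr hωγ⟩, fun π' t' ht' => ?_⟩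
    rcases hs π' t' ht' with ⟨π, hπ, he⟩ | h1 | ⟨π, t, hπ, hd, he⟩
    · obtain ⟨F, hF, hle⟩ := ih π t' hπ
      exact ⟨F, fun q hq => ⟨(hF q hq).1, (hF q hq).2.edge (Or.inl he)⟩, hle⟩
    -- Nulls with an empty frontier have depth `1` without any special path; they are the reason for
    -- the `+ 1` in the bound.
    · exact ⟨∅, by simp, by simpa using h1⟩
    · obtain ⟨F, hF, hle⟩ := ih π t hπ
      -- Otherwise a special path would lead from `π` to itself, and `π` is supported by the
      -- database.
      have hπF : π ∉ F := fun hc =>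
        (hF π hc).2.not_weaklyAcyclic hω (by rwa [hπ.shape_eq]) hwa
      refine ⟨insert π F, fun q hq => ?_, ?_⟩
      · rcases Finset.mem_insert.mp hq with rfl | hq
        · exact ⟨by rw [hπ.shape_eq]; exact harrow.1, he.specialPath⟩
        · exact ⟨(hF q hq).1, (hF q hq).2.edge (Or.inr he)⟩
      · rw [Finset.card_insert_of_notMem hπF]
        omega

/-- The position of the term itself has no special path to itself, so it can be added to the finite
set of positions, which absorbs the `+ 1`. -/
theorem depth_le_of_weaklyAcyclic {D : Set (Fact S)} {Γ : Set (TGD S)}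
    (hlin : ∀ σ ∈ Γ, σ.IsLinear) (hwa : WeaklyAcyclic (simpleDB D) (simpleTGDs Γ))
    {P : Finset (Position S.simple)} (hP : ∀ π : Position S.simple, π.1 ∈ sch (simpleTGDs Γ) → π ∈ P)
    {α β : Atom S (GTerm S)} (hα : α ∈ toInstance D)
    (hβ : Relation.ReflTransGen (Succ Γ) α β) (i) : (β.args i).depth ≤ P.card := by
  classical
  obtain ⟨hreach, hdepth⟩ := exists_finset_depth_le hlin hwa hα hβ
  rcases hβ.cases_tail with rfl | ⟨γ, -, hs⟩
  · obtain ⟨α, hα, rfl⟩ := hα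
    simp [Atom.map, GTerm.depth]
  · have hsch := (hs.exists_simple hlin).1.2.1
    obtain ⟨ω, hω, hωβ⟩ : ∃ ω ∈ simpleDB D, Reachable (simpleTGDs Γ) ω.pred β.shape := by
      obtain ⟨ω, hω, he | hr⟩ := hreach
      · exact ⟨ω, hω, .single ⟨by rw [he]; exact hsch, hsch, Or.inl he⟩⟩
      · exact ⟨ω, hω, hr⟩
    obtain ⟨π, hπ⟩ := β.exists_position i
    obtain ⟨F, hF, hle⟩ := hdepth π _ hπ
    have hπF : π ∉ F := fun hc =>
      (hF π hc).2.not_weaklyAcyclic hω (by rwa [hπ.shape_eq]) hwa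
    have : (insert π F).card ≤ P.card := by
      refine Finset.card_le_card fun q hq => hP q ?_
      rcases Finset.mem_insert.mp hq with rfl | hq
      · rw [hπ.shape_eq]; exact hsch
      · exact (hF q hq).1
    rw [Finset.card_insert_of_notMem hπF] at this
    omega

theorem atoms_finite {Γ : Set (TGD S)} (hΓ : Γ.Finite) : (atoms Γ).Finite := by
  have : atoms Γ = ⋃ σ ∈ Γ, ((σ.body : Set (Atom S Var)) ∪ σ.head) := by
    ext a
    simp [atoms]
  rw [this]
  exact hΓ.biUnion fun σ _ => σ.body.finite_toSet.union σ.head.finite_toSet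

theorem sch_finite {Γ : Set (TGD S)} (hΓ : Γ.Finite) : (sch Γ).Finite := (atoms_finite hΓ).image _

theorem arity_le_maxArity {Γ : Set (TGD S)} (hΓ : Γ.Finite) {R : S.Pred} (hR : R ∈ sch Γ) :
    S.arity R ≤ maxArity Γ :=
  le_csSup ((sch_finite hΓ).image _).bddAbove ⟨R, hR, rfl⟩

theorem ident_mem {n : ℕ} {T : Type*} [DecidableEq T] (t : Fin n → T) (i : Fin n) :
    0 < ident t i ∧ ident t i ≤ n := by
  obtain ⟨k, hk, hki, -⟩ := exists_first t i
  rw [ident_of_first t hk hki]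
  refine ⟨Finset.card_pos.mpr ⟨k, by simp [hk]⟩, ?_⟩
  simpa using Finset.card_le_univ ((firsts t).filter fun j => j ≤ k)

theorem exists_shape_of_mem_sch_simple {Γ : Set (TGD S)} {R : SimplePred S}
    (hR : R ∈ sch (simpleTGDs Γ)) : ∃ a : Atom S Var, a.pred ∈ sch Γ ∧ R = a.shape := by
  obtain ⟨c, ⟨τ, hτ, hc⟩, rfl⟩ := hR
  obtain ⟨σ, hσ, a, ha, f, hf, rfl⟩ := mem_simpleTGDs_iff.mp hτ
  rcases hc with hc | hc
  · obtain ⟨b, hb, rfl⟩ := TGD.mem_simplify_body_iff.mp hc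
    exact ⟨b.map f, ⟨b, ⟨σ, hσ, Or.inl hb⟩, rfl⟩, rfl⟩
  · obtain ⟨b, hb, rfl⟩ := TGD.mem_simplify_head_iff.mp hc
    exact ⟨b.map f, ⟨b, ⟨σ, hσ, Or.inr hb⟩, rfl⟩, rfl⟩

/-- With `m` the maximum arity, each predicate has at most `m ^ m` identifier tuples, and each
simplified predicate has at most `m` positions. -/
theorem exists_positions_card_le {Γ : Set (TGD S)} (hΓ : Γ.Finite) :
    ∃ P : Finset (Position S.simple), (∀ π : Position S.simple, π.1 ∈ sch (simpleTGDs Γ) → π ∈ P) ∧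
      P.card ≤ depthBound Γ := by
  classical
  set m := maxArity Γ with hm
  -- Identifiers lie between `1` and `m`, hence the shift by one; the default `0` is never reached
  -- for predicates of arity at most `m`.
  let G : S.Pred × (Fin m → Fin m) → SimplePred S := fun p =>
    ⟨p.1, fun i => if hi : i.1 < m then (p.2 ⟨i, hi⟩).1 + 1 else 0⟩
  let Q : Finset (S.Pred × (Fin m → Fin m)) := (sch_finite hΓ).toFinset ×ˢ Finset.univ
  let R : Finset S.simple.Pred :=
    (Q.image G).filter fun r : SimplePred S => S.arity r.base ≤ m
  refine ⟨R.sigma fun _ => Finset.univ, fun π hπ => Finset.mem_sigma.mpr ⟨?_, Finset.mem_univ _⟩,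
    ?_⟩
  · obtain ⟨a, ha, he⟩ := exists_shape_of_mem_sch_simple hπ
    rw [he]
    have hle := arity_le_maxArity hΓ ha
    have hpos := S.arity_pos a.pred
    refine Finset.mem_filter.mpr ⟨Finset.mem_image.mpr ⟨(a.pred, fun i =>
      if hi : i.1 < S.arity a.pred then ⟨ident a.args ⟨i, hi⟩ - 1, ?_⟩ else i), ?_, ?_⟩, hle⟩
    · have := ident_mem a.args ⟨i, hi⟩
      omega
    · simpa [Q] using ha
    · refine congrArg (SimplePred.mk a.pred) (funext fun i : Fin (S.arity a.pred) => ?_)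
      have := ident_mem a.args i
      have hi : i.1 < m := i.2.trans_le hle
      rw [dif_pos hi]
      simp only [i.2, dif_pos]
      exact Nat.sub_add_cancel this.1
  · rw [Finset.card_sigma]
    have h1 : ∀ r ∈ R, (Finset.univ : Finset (Fin (S.simple.arity r))).card ≤ m := by
      intro r hr
      rw [Finset.card_univ, Fintype.card_fin]
      refine le_trans ?_ (Finset.mem_filter.mp hr).2
      exact (Finset.card_le_univ (firsts r.ids)).trans_eq (Fintype.card_fin _)
    have h2 : R.card ≤ (sch Γ).ncard * m ^ m := by
      refine (Finset.card_filter_le _ _).trans (Finset.card_image_le.trans ?_)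
      rw [Finset.card_product, Set.ncard_eq_toFinset_card _ (sch_finite hΓ)]
      simp
    calc _ ≤ R.card * m := by simpa using Finset.sum_le_card_nsmul R _ m h1
      _ ≤ (sch Γ).ncard * m ^ m * m := Nat.mul_le_mul_right _ h2
      _ = depthBound Γ := by rw [depthBound, ← hm, pow_succ, mul_assoc]

end DepthBound

/-! ### Counting the derivable atoms of bounded depth. -/

section Counting

variable {S : Signature.{u}}

/-- The arguments of an atom, as a tuple of length `m`. -/
def Atom.tuple {T : Type*} (m : ℕ) (a : Atom S T) : Fin m → T := fun i =>
  if hi : i.1 < S.arity a.pred then a.args ⟨i, hi⟩ else a.args ⟨0, S.arity_pos _⟩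

theorem Atom.mem_range_tuple {T : Type*} {m : ℕ} {a : Atom S T} (hm : S.arity a.pred ≤ m)
    (i : Fin (S.arity a.pred)) : a.args i ∈ Set.range (a.tuple m) :=
  ⟨Fin.castLE hm i, dif_pos i.2⟩

/-- The tuples of terms of the atoms in which the nulls of depth `n` are created by a derivation
that starts with `α`. -/
def bags (Γ : Set (TGD S)) (m : ℕ) (α : Atom S (GTerm S)) : ℕ → Set (Fin m → GTerm S)
  | 0 => {α.tuple m}
  | n + 1 => {t | ∃ s ∈ bags Γ m α n, ∃ σ ∈ Γ, ∃ b ∈ σ.head, ∃ h : Var → GTerm S,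
      (∀ x ∈ σ.frontier, h x ∈ Set.range s) ∧ t = (b.map (extend σ h)).tuple m}

/-- The bag of a null is the tuple of the atom that creates it, one level above a bag containing its
whole frontier. A term that is merely passed on keeps its bag, so the level equals the depth however
long the derivation is. -/
theorem exists_bag {Γ : Set (TGD S)} (hlin : ∀ σ ∈ Γ, σ.IsLinear) {m : ℕ}
    (hm : ∀ R ∈ sch Γ, S.arity R ≤ m) {α β : Atom S (GTerm S)} (hα : ∀ i, (α.args i).depth = 0)
    (hαm : S.arity α.pred ≤ m) (hβ : Relation.ReflTransGen (Succ Γ) α β) (k) :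
    ∃ B ∈ bags Γ m α (β.args k).depth,
      ∀ j, (β.args j).depth ≤ (β.args k).depth → β.args j ∈ Set.range B := by
  induction hβ with
  | refl =>
    rw [hα]
    exact ⟨α.tuple m, rfl, fun j _ => Atom.mem_range_tuple hαm j⟩
  | @tail β γ _ hs ih =>
    obtain ⟨σ, hσ, h, hbody, b, hb, rfl⟩ := hs
    obtain ⟨a, ha⟩ := (hlin σ hσ).exists_body
    obtain rfl := hbody a (by simp [ha])
    have hbm : S.arity b.pred ≤ m := hm _ ⟨b, ⟨σ, hσ, Or.inr hb⟩, rfl⟩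
    have hfr (y) (hy : y ∈ σ.frontier) : ∃ i, a.args i = y := (TGD.mem_bodyVars_iff ha).mp hy.1
    simp only [Atom.map] at ih k ⊢
    by_cases hk : b.args k ∈ σ.frontier
    · rw [extend_of_mem hk]
      obtain ⟨k', hk'⟩ := hfr _ hk
      obtain ⟨B, hB, hsub⟩ := ih k'
      rw [hk'] at hB hsub
      refine ⟨B, hB, fun j hj => ?_⟩
      by_cases hjf : b.args j ∈ σ.frontier
      · rw [extend_of_mem hjf] at hj ⊢
        obtain ⟨j', hj'⟩ := hfr _ hjf
        rw [← hj'] at hj ⊢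
        exact hsub j' hj
      · rw [extend_of_notMem hjf] at hj
        -- Next to a frontier term, a fresh null is too deep to be required in the bag.
        exact absurd (GTerm.depth_lt_null _ (fun y => h y.1) ⟨_, hk⟩) (not_lt.mpr hj)
    · rw [extend_of_notMem hk]
      refine ⟨(b.map (extend σ h)).tuple m, ?_,
        fun j _ => Atom.mem_range_tuple (a := b.map (extend σ h)) hbm j⟩
      rcases GTerm.depth_null_eq (b.args k) (fun y : {x : Var // x ∈ σ.frontier} => h y.1) with
        ⟨he, h1⟩ | ⟨y, hy, hmax⟩
      · rw [h1]
        -- With an empty frontier nothing is demanded of the parent bag, so the root bag serves.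
        exact ⟨_, rfl, σ, hσ, b, hb, h, fun x hx => (he.false ⟨x, hx⟩).elim, rfl⟩
      · rw [hy]
        obtain ⟨k', hk'⟩ := hfr _ y.2
        obtain ⟨B, hB, hsub⟩ := ih k'
        rw [hk'] at hB hsub
        refine ⟨B, hB, σ, hσ, b, hb, h, fun x hx => ?_, rfl⟩
        obtain ⟨j', rfl⟩ := hfr _ hx
        exact hsub j' (hmax ⟨_, hx⟩)

/-- Arities are positive, so a head atom has a variable and this variable identifies the TGD. In the
count, the atom alone then encodes both. -/
theorem eq_of_mem_head {Γ : Set (TGD S)} (hdisj : Γ.PairwiseDisjoint TGD.vars)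
    {σ τ : TGD S} (hσ : σ ∈ Γ) (hτ : τ ∈ Γ) {b : Atom S Var} (hbσ : b ∈ σ.head)
    (hbτ : b ∈ τ.head) : σ = τ :=
  hdisj.elim_set hσ hτ (b.args ⟨0, S.arity_pos _⟩) (Or.inr ⟨b, hbσ, _, rfl⟩)
    (Or.inr ⟨b, hbτ, _, rfl⟩)

/-- A child bag is determined by its parent, a head atom, and a map from the slots of the body atom
to the slots of the parent that says where the frontier values are found. This gives at most `(atoms
Γ).ncard * m ^ m` children. -/
theorem exists_finset_bags {Γ : Set (TGD S)} (hΓ : Γ.Finite) (hlin : ∀ σ ∈ Γ, σ.IsLinear)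
    (hdisj : Γ.PairwiseDisjoint TGD.vars) {m : ℕ} (hm0 : 0 < m)
    (hm : ∀ R ∈ sch Γ, S.arity R ≤ m) (α : Atom S (GTerm S)) (n : ℕ) :
    ∃ F : Finset (Fin m → GTerm S), bags Γ m α n ⊆ F ∧
      F.card ≤ ((atoms Γ).ncard * m ^ m) ^ n := by
  classical
  induction n with
  | zero => exact ⟨{α.tuple m}, by simp [bags], by simp⟩
  | succ n ih =>
    obtain ⟨F, hF, hcard⟩ := ih
    -- `idx` gives a slot of a frontier variable in the body atom, and `w` reads the variable at a
    -- slot.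
    have hidx : ∀ σ : TGD S, ∃ (idx : Var → Fin m) (w : Fin m → Var),
        σ ∈ Γ → ∀ x ∈ σ.frontier, w (idx x) = x := by
      intro σ
      by_cases hσ : σ ∈ Γ
      · obtain ⟨a, ha⟩ := (hlin σ hσ).exists_body
        have ham : S.arity a.pred ≤ m := hm _ ⟨a, ⟨σ, hσ, Or.inl (by simp [ha])⟩, rfl⟩
        have : ∀ x, ∃ i : Fin m, x ∈ σ.frontier → a.tuple m i = x := by
          intro x
          by_cases hx : x ∈ σ.frontier
          · obtain ⟨j, rfl⟩ := (TGD.mem_bodyVars_iff ha).mp hx.1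
            obtain ⟨i, hi⟩ := Atom.mem_range_tuple ham j
            exact ⟨i, fun _ => hi⟩
          · exact ⟨⟨0, hm0⟩, fun h => absurd h hx⟩
        choose idx hidx using this
        exact ⟨idx, a.tuple m, fun _ => hidx⟩
      · exact ⟨fun _ => ⟨0, hm0⟩, fun _ => 0, fun h => absurd h hσ⟩
    choose idx w hw using hidx
    let G : Atom S Var × (Fin m → Fin m) × (Fin m → GTerm S) → Fin m → GTerm S := fun p =>
      if hp : ∃ σ ∈ Γ, p.1 ∈ σ.head then
        (p.1.map (extend hp.choose fun x => p.2.2 (p.2.1 (idx hp.choose x)))).tuple m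
      else p.2.2
    refine ⟨((atoms_finite hΓ).toFinset ×ˢ Finset.univ ×ˢ F).image G, ?_, ?_⟩
    · rintro _ ⟨s, hs, σ, hσ, b, hb, h, hh, rfl⟩
      have : ∀ x, ∃ j : Fin m, x ∈ σ.frontier → s j = h x := by
        intro x
        by_cases hx : x ∈ σ.frontier
        · obtain ⟨j, hj⟩ := hh x hx
          exact ⟨j, fun _ => hj⟩
        · exact ⟨⟨0, hm0⟩, fun h => absurd h hx⟩
      choose j hj using this
      refine Finset.mem_coe.mpr (Finset.mem_image.mpr ⟨(b, fun i => j (w σ i), s), ?_, ?_⟩)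
      · simp only [Finset.mem_product, Set.Finite.mem_toFinset, Finset.mem_univ, true_and]
        exact ⟨⟨σ, hσ, Or.inr hb⟩, hF hs⟩
      · have hp : ∃ τ ∈ Γ, b ∈ τ.head := ⟨σ, hσ, hb⟩
        have he : hp.choose = σ := eq_of_mem_head hdisj hp.choose_spec.1 hσ hp.choose_spec.2 hb
        simp only [G, dif_pos hp]
        rw [he, extend_congr (g := h)]
        intro x hx
        rw [hw σ hσ x hx, hj x hx]
    · refine Finset.card_image_le.trans ?_
      rw [Finset.card_product, Finset.card_product, ← Set.ncard_eq_toFinset_card _ (atoms_finite hΓ)]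
      simp only [Finset.card_univ, Fintype.card_fun, Fintype.card_fin]
      rw [pow_succ', ← mul_assoc]
      exact Nat.mul_le_mul_left _ hcard

theorem Succ.pred_mem_sch {Γ : Set (TGD S)} (hlin : ∀ σ ∈ Γ, σ.IsLinear)
    {β γ : Atom S (GTerm S)} (h : Succ Γ β γ) : β.pred ∈ sch Γ ∧ γ.pred ∈ sch Γ := by
  obtain ⟨σ, hσ, h, hbody, b, hb, rfl⟩ := h
  obtain ⟨a, ha⟩ := (hlin σ hσ).exists_body
  obtain rfl := hbody a (by simp [ha])
  exact ⟨⟨a, ⟨σ, hσ, Or.inl (by simp [ha])⟩, rfl⟩, ⟨b, ⟨σ, hσ, Or.inr hb⟩, rfl⟩⟩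

/-- Both `A * m ^ m` and `s * m ^ m` are at most `(A * s * m) ^ m`, so already the exponent `m * (d
+ 1)` would do. -/
theorem pow_mul_le_size_pow {A s m n d : ℕ} (hA : 0 < A) (hs : 0 < s) (hm : 0 < m) (hn : n ≤ d) :
    (A * m ^ m) ^ n * (s * m ^ m) ≤ (A * s * m) ^ (2 * m * (d + 1)) := by
  have hK : 0 < A * s * m := by positivity
  have h1 : A * m ^ m ≤ (A * s * m) ^ m := by
    calc A * m ^ m ≤ A ^ m * m ^ m := Nat.mul_le_mul_right _ (Nat.le_self_pow hm.ne' A)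
      _ = (A * m) ^ m := (mul_pow _ _ _).symm
      _ ≤ (A * s * m) ^ m := by gcongr; exact Nat.le_mul_of_pos_right A hs
  have h2 : s * m ^ m ≤ (A * s * m) ^ m := by
    calc s * m ^ m ≤ s ^ m * m ^ m := Nat.mul_le_mul_right _ (Nat.le_self_pow hm.ne' s)
      _ = (s * m) ^ m := (mul_pow _ _ _).symm
      _ ≤ (A * s * m) ^ m := by gcongr; exact Nat.le_mul_of_pos_left s hA
  calc (A * m ^ m) ^ n * (s * m ^ m) ≤ ((A * s * m) ^ m) ^ n * (A * s * m) ^ m := by gcongr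
    _ = (A * s * m) ^ (m * (n + 1)) := by rw [← pow_mul, ← pow_add]; ring_nf
    _ ≤ (A * s * m) ^ (2 * m * (d + 1)) := by
      refine Nat.pow_le_pow_right hK ?_
      nlinarith [Nat.mul_le_mul_left m hn]

theorem sizeBound_pos {Γ : Set (TGD S)} (hΓ : Γ.Finite) : 0 < sizeBound Γ := by
  refine Nat.mul_pos (Nat.succ_pos _) ?_
  rcases (atoms Γ).eq_empty_or_nonempty with h | ⟨a, ha⟩
  · have hm : maxArity Γ = 0 := by simp [maxArity, sch, h]
    simp [hm]
  · have hsch : a.pred ∈ sch Γ := ⟨a, ha, rfl⟩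
    refine pow_pos (Nat.mul_pos (Nat.mul_pos ?_ ?_) ?_) _
    · exact (Set.ncard_pos (atoms_finite hΓ)).mpr ⟨a, ha⟩
    · exact (Set.ncard_pos (sch_finite hΓ)).mpr ⟨_, hsch⟩
    · exact (S.arity_pos _).trans_le (arity_le_maxArity hΓ hsch)

theorem exists_finset_derivable_from {Γ : Set (TGD S)} (hΓ : Γ.Finite)
    (hlin : ∀ σ ∈ Γ, σ.IsLinear) (hdisj : Γ.PairwiseDisjoint TGD.vars)
    {α : Atom S (GTerm S)} (hα : ∀ i, (α.args i).depth = 0)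
    (hdepth : ∀ β, Relation.ReflTransGen (Succ Γ) α β → ∀ i, (β.args i).depth ≤ depthBound Γ) :
    ∃ F : Finset (Atom S (GTerm S)), (∀ β, Relation.ReflTransGen (Succ Γ) α β → β ∈ F) ∧
      F.card ≤ sizeBound Γ := by
  classical
  by_cases hpred : α.pred ∈ sch Γ
  · have hm0 : 0 < maxArity Γ := (S.arity_pos _).trans_le (arity_le_maxArity hΓ hpred)
    have hs0 : 0 < (sch Γ).ncard := (Set.ncard_pos (sch_finite hΓ)).mpr ⟨_, hpred⟩
    have hA0 : 0 < (atoms Γ).ncard := by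
      obtain ⟨a, ha, -⟩ := hpred
      exact (Set.ncard_pos (atoms_finite hΓ)).mpr ⟨a, ha⟩
    set m := maxArity Γ with hmdef
    set d := depthBound Γ with hddef
    have hm : ∀ R ∈ sch Γ, S.arity R ≤ m := fun R hR => arity_le_maxArity hΓ hR
    choose F hF hcard using exists_finset_bags hΓ hlin hdisj hm0 hm α
    let G : (Fin m → GTerm S) × S.Pred × (Fin m → Fin m) → Atom S (GTerm S) := fun p =>
      ⟨p.2.1, fun i => if hi : i.1 < m then p.1 (p.2.2 ⟨i, hi⟩) else p.1 ⟨0, hm0⟩⟩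
    refine ⟨(Finset.range (d + 1)).biUnion fun n =>
      (F n ×ˢ (sch_finite hΓ).toFinset ×ˢ Finset.univ).image G, fun β hβ => ?_, ?_⟩
    · have hβs : β.pred ∈ sch Γ := by
        rcases hβ.cases_tail with rfl | ⟨γ, -, hs⟩
        · exact hpred
        · exact (hs.pred_mem_sch hlin).2
      have : Nonempty (Fin (S.arity β.pred)) := ⟨⟨0, S.arity_pos _⟩⟩
      -- The bag of an argument of maximal depth contains all arguments, so `β` is determined by
      -- that depth, the bag, its predicate and a choice of slots.
      obtain ⟨k, hk⟩ := Finite.exists_max fun i => (β.args i).depth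
      obtain ⟨B, hB, hsub⟩ := exists_bag hlin hm hα (hm _ hpred) hβ k
      choose g hg using fun i => hsub i (hk i)
      refine Finset.mem_biUnion.mpr ⟨_, Finset.mem_range.mpr (Nat.lt_succ_of_le (hdepth β hβ k)),
        Finset.mem_image.mpr ⟨(B, β.pred, fun i =>
          if hi : i.1 < S.arity β.pred then g ⟨i, hi⟩ else i), ?_, ?_⟩⟩
      · simpa using ⟨hF _ hB, hβs⟩
      · refine congrArg (Atom.mk β.pred) (funext fun i : Fin (S.arity β.pred) => ?_)
        have hi : i.1 < m := i.2.trans_le (hm _ hβs)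
        rw [dif_pos hi]
        simp only [i.2, dif_pos]
        exact hg i
    · refine Finset.card_biUnion_le.trans ?_
      calc _ ≤ ∑ n ∈ Finset.range (d + 1), size Γ ^ (2 * m * (d + 1)) := by
            refine Finset.sum_le_sum fun n hn => Finset.card_image_le.trans ?_
            rw [Finset.card_product, Finset.card_product,
              ← Set.ncard_eq_toFinset_card _ (sch_finite hΓ)]
            simp only [Finset.card_univ, Fintype.card_fun, Fintype.card_fin]
            exact (Nat.mul_le_mul_right _ (hcard n)).trans
              (pow_mul_le_size_pow hA0 hs0 hm0 (Nat.lt_succ_iff.mp (Finset.mem_range.mp hn)))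
        _ = sizeBound Γ := by simp [sizeBound, ← hmdef, ← hddef]
  -- No TGD applies to an atom whose predicate is outside the schema, so it derives only itself.
  · refine ⟨{α}, fun β hβ => ?_, (Finset.card_singleton α).trans_le (sizeBound_pos hΓ)⟩
    rcases hβ.cases_head with rfl | ⟨γ, hs, -⟩
    · simp
    · exact absurd (hs.pred_mem_sch hlin).1 hpred

theorem encard_derivable_le {D : Set (Fact S)} (hD : D.Finite) {Γ : Set (TGD S)} (hΓ : Γ.Finite)
    (hlin : ∀ σ ∈ Γ, σ.IsLinear) (hdisj : Γ.PairwiseDisjoint TGD.vars)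
    (hwa : WeaklyAcyclic (simpleDB D) (simpleTGDs Γ)) :
    (derivable D Γ).encard ≤ D.encard * (sizeBound Γ : ℕ∞) := by
  classical
  obtain ⟨P, hP, hPcard⟩ := exists_positions_card_le hΓ
  have : ∀ α : Fact S, ∃ F : Finset (Atom S (GTerm S)), α ∈ D →
      (∀ β, Relation.ReflTransGen (Succ Γ) (α.map .const) β → β ∈ F) ∧
        F.card ≤ sizeBound Γ := by
    intro α
    by_cases hα : α ∈ D
    · obtain ⟨F, hF⟩ := exists_finset_derivable_from hΓ hlin hdisj (α := α.map .const)
        (by simp [Atom.map, GTerm.depth]) fun β hβ i =>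
          (depth_le_of_weaklyAcyclic hlin hwa hP ⟨α, hα, rfl⟩ hβ i).trans hPcard
      exact ⟨F, fun _ => hF⟩
    · exact ⟨∅, fun h => absurd h hα⟩
  choose F hF using this
  have hsub : derivable D Γ ⊆ (hD.toFinset.biUnion F : Finset (Atom S (GTerm S))) := by
    rintro β ⟨_, ⟨α, hα, rfl⟩, hβ⟩
    exact Finset.mem_coe.mpr (Finset.mem_biUnion.mpr ⟨α, by simpa using hα, (hF α hα).1 β hβ⟩)
  refine (Set.encard_le_encard hsub).trans ?_
  rw [Set.encard_coe_eq_coe_finsetCard, hD.encard_eq_coe_toFinset_card]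
  exact_mod_cast Finset.card_biUnion_le_card_mul _ _ _ fun α hα =>
    (hF α (by simpa using hα)).2

theorem Instance.finite_of_encard_le {D : Set (Fact S)} (hD : D.Finite) {n : ℕ}
    {I : Instance S} (h : I.encard ≤ D.encard * (n : ℕ∞)) : I.Finite := by
  rw [hD.encard_eq_coe_toFinset_card] at h
  exact Set.finite_of_encard_le_coe (k := hD.toFinset.card * n) (by exact_mod_cast h)

end Counting

end ChaseTGD

/-! ### Uniqueness of the chase and the equivalent characterizations of termination. -/

theorem mainTheorem2 (S : ChaseTGD.Signature.{u})
    (D : Set (ChaseTGD.Fact S)) (hD : D.Finite)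
    (Γ : Set (ChaseTGD.TGD S)) (hΓ : Γ.Finite)
    (hlinear : ∀ σ ∈ Γ, σ.IsLinear)
    (hvars : Γ.PairwiseDisjoint ChaseTGD.TGD.vars) :
    (∃! J, ChaseTGD.IsChaseResult D Γ J) ∧
    List.TFAE [
      Γ ∈ ChaseTGD.CTForall D,
      Γ ∈ ChaseTGD.CTExists D,
      (ChaseTGD.chase D Γ).Finite,
      (ChaseTGD.chase D Γ).encard ≤ D.encard * (ChaseTGD.sizeBound Γ : ℕ∞),
      ChaseTGD.WeaklyAcyclic (ChaseTGD.simpleDB D) (ChaseTGD.simpleTGDs Γ)] := by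
  refine ⟨ChaseTGD.existsUnique_isChaseResult hD hΓ hlinear, ?_⟩
  rw [ChaseTGD.chase_eq_derivable hD hΓ hlinear]
  tfae_have 1 → 2 := ChaseTGD.ctExists_of_ctForall hD hΓ hlinear
  tfae_have 2 → 3 := ChaseTGD.derivable_finite_of_ctExists hD hlinear
  tfae_have 3 → 1 := ChaseTGD.ctForall_of_derivable_finite hlinear
  tfae_have 3 → 5 := ChaseTGD.weaklyAcyclic_of_derivable_finite hlinear
  tfae_have 5 → 4 := ChaseTGD.encard_derivable_le hD hΓ hlinear hvars
  tfae_have 4 → 3 := ChaseTGD.Instance.finite_of_encard_le hD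
  tfae_finish
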